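/- Let $p>0$ and $\nu\ge-\tfrac12$ be real and let $a,b\in\mathbb C$ be arbitrary. Let $K_\mu$ denote the modified Bessel function of the second kind, $K_\mu(z)=\int_0^\infty e^{-z\cosh s}\cosh(\mu s)\,ds$ for $\operatorname{Re}z>0$, and put \[ I(a,b;z)=\sqrt{\frac{2p}{\pi}}\int_0^1 t^{a-\frac12}(1-t)^{b-\frac12}e^{zt}K_\nu\Bigl(\frac{p}{t(1-t)}\Bigr)\,dt\qquad(z\in\mathbb C). \] Define $a_k(\nu)=\dfrac{1}{k!\,8^k}\prod_{r=1}^k\bigl(4\nu^2-(2r-1)^2\bigr)$ (so $a_0(\nu)=1$), define $c_\ell(k)=c_\ell(k;p,b)$ by the Taylor expansion \[ (1-w)^{b+k}e^{-pw/(1-w)}=\sum_{\ell\ge0}\frac{(-1)^\ell c_\ell(k)}{\ell!}\,w^\ell\qquad(|w|<1), \] and set \[ D_r=D_r(b)=\sum_{\ell=0}^r\frac{(-1)^\ell p^\ell}{\ell!}\,a_{r-\ell}(\nu)\,c_\ell(r-\ell)\qquad(r\ge0). \] Then the integral $I(a,b;z)$ converges absolutely for every $z\in\mathbb C$, $D_0=1$,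 and the following hold, all powers and roots being principal. (i) As $|x|\to\infty$ in $|\arg x|<\tfrac12\pi$, \[ I(a,b;-x)\sim 2e^{-p}\Bigl(\frac px\Bigr)^{(a+1)/2}\sum_{r=0}^\infty \frac{D_r(b)\,K_{a+1+r}(2\sqrt{px})}{(px)^{r/2}} . \] (ii) $I(a,b;z)=e^{z}I(b,a;-z)$ for every $z\in\mathbb C$. (iii) As $|z|\to\infty$ in $|\arg z|<\tfrac12\pi$, \[ I(a,b;z)\sim 2e^{z-p}\Bigl(\frac pz\Bigr)^{(b+1)/2}\sum_{r=0}^\infty \frac{D_r(a)\,K_{b+1+r}(2\sqrt{pz})}{(pz)^{r/2}}, \] where $D_r(a)$ is $D_r$ with $b$ replaced by $a$. Here an expansion $f\sim\sum_r d_r\varphi_r$ in $|\arg x|<\tfrac12\pi$ means that for each fixed $\delta>0$, as $|x|\to\infty$ uniformly in $|\arg x|\le\tfrac12\pi-\delta$, one has $\varphi_{r+1}=o(\varphi_r)$ for all $r\ge0$ and $f-\sum_{r<N}d_r\varphi_r=O(\varphi_N)$ for all $N\ge0$; in (i), $\varphi_r(x)=2e^{-p}(p/x)^{(a+1)/2}K_{a+1+r}(2\sqrt{px})(px)^{-r/2}$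 and $d_r=D_r(b)$, and in (iii), $\varphi_r(z)=2e^{z-p}(p/z)^{(b+1)/2}K_{b+1+r}(2\sqrt{pz})(pz)^{-r/2}$ and $d_r=D_r(a)$. -/

import Mathlib

open Filter Asymptotics MeasureTheory
open scoped Topology

noncomputable section

namespace BesselLaplace

/-- The modified Bessel (Macdonald) function `K_μ(z)` of complex order `μ`, for `Re z > 0`, through
its integral representation `K_μ(z) = ∫_0^∞ e^{-z cosh s} cosh (μ s) ds`. -/
def besselK (μ z : ℂ) : ℂ :=
  ∫ s in Set.Ioi (0 : ℝ), Complex.exp (-z * Complex.cosh s) * Complex.cosh (μ * s)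

/-- The function `t^{a-1/2} (1-t)^{b-1/2} e^{zt} K_ν(p/(t(1-t)))`. -/
def integrand (p ν : ℝ) (a b z : ℂ) (t : ℝ) : ℂ :=
  (t : ℂ) ^ (a - 1 / 2) * (1 - (t : ℂ)) ^ (b - 1 / 2) * Complex.exp (z * t)
    * besselK ν ((p / (t * (1 - t)) : ℝ) : ℂ)

/-- `I(a,b;z) = √(2p/π) ∫_0^1 t^{a-1/2} (1-t)^{b-1/2} e^{zt} K_ν(p/(t(1-t))) dt`. -/
def I (p ν : ℝ) (a b z : ℂ) : ℂ :=
  (Real.sqrt (2 * p / Real.pi) : ℂ) * ∫ t in (0 : ℝ)..1, integrand p ν a b z t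

/-- `a_k(ν) = ∏_{r=1}^k (4ν² - (2r-1)²) / (k! 8^k)`. -/
def besselCoeff (ν : ℝ) (k : ℕ) : ℝ :=
  (∏ r ∈ Finset.Icc 1 k, (4 * ν ^ 2 - (2 * (r : ℝ) - 1) ^ 2)) / ((k.factorial : ℝ) * 2 ^ (3 * k))

/-- The coefficient `c_ℓ(k)`, normalised by
`(1-w)^{b+k} e^{-pw/(1-w)} = ∑_ℓ (-1)^ℓ c_ℓ(k) w^ℓ / ℓ!`. -/
def taylorCoeff (p : ℝ) (b : ℂ) (ℓ k : ℕ) : ℂ :=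
  (-1) ^ ℓ * iteratedDeriv ℓ
    (fun w : ℂ => (1 - w) ^ (b + (k : ℂ)) * Complex.exp (-((p : ℂ) * w / (1 - w)))) 0

/-- `D_r = ∑_{ℓ=0}^r ((-1)^ℓ p^ℓ / ℓ!) a_{r-ℓ}(ν) c_ℓ(r-ℓ)`. -/
def D (p ν : ℝ) (b : ℂ) (r : ℕ) : ℂ :=
  ∑ ℓ ∈ Finset.range (r + 1), (-1) ^ ℓ * (p : ℂ) ^ ℓ / (ℓ.factorial : ℂ)
    * (besselCoeff ν (r - ℓ) : ℂ) * taylorCoeff p b ℓ (r - ℓ)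

/-- `2 e^{-p} (p/x)^{(a+1)/2} K_{a+1+r}(2√(px)) (px)^{-r/2}`, with principal powers. -/
def scale (p : ℝ) (a : ℂ) (r : ℕ) (x : ℂ) : ℂ :=
  2 * Complex.exp (-(p : ℂ)) * ((p : ℂ) / x) ^ ((a + 1) / 2)
    * besselK (a + 1 + (r : ℂ)) (2 * ((p : ℂ) * x) ^ (1 / 2 : ℂ))
    * ((p : ℂ) * x) ^ (-(r : ℂ) / 2)

/-- The filter of `|x| → ∞` inside the closed sector `|arg x| ≤ π/2 - δ`. -/
def sectorAtInfinity (δ : ℝ) : Filter ℂ :=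
  Bornology.cobounded ℂ ⊓ 𝓟 {x : ℂ | |Complex.arg x| ≤ Real.pi / 2 - δ}

/-- `f ~ ∑_r c_r φ_r` along `l`: the `φ_r` form an asymptotic sequence along `l`, and for every `N`
the remainder after the first `N` terms is `O(φ_N)`. -/
def HasAsymptoticExpansion (l : Filter ℂ) (f : ℂ → ℂ) (c : ℕ → ℂ) (φ : ℕ → ℂ → ℂ) : Prop :=
  (∀ r : ℕ, φ (r + 1) =o[l] φ r) ∧
    ∀ N : ℕ, (fun x => f x - ∑ r ∈ Finset.range N, c r * φ r x) =O[l] φ N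

end BesselLaplace

end

namespace BesselLaplace

/-! The reflection t ↦ 1 - t fixes p/(t(1-t)) and gives (ii); it also turns (i) into (iii), so the
work lies in (i), in `expansion_neg`.

For large x only small t matters. The partial fraction p/(t(1-t)) = p/t + p/(1-t) splits the
exponential decay of K_ν into e^{-p/t}, which pairs with e^{-xt}, and a factor analytic at 0. The
Hankel expansion of K_ν and the Taylor expansion of (1-t)^{b+k} e^{-pt/(1-t)} then give the rest of
the integrand, apart from t^a, as e^{-p} ∑ D_r (t/p)^r, with error O(|t|^N) in the sector |arg t| ≤
π/4 (`reducedAmplitude_expansion`).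

In the variable w = log t the contour is moved to Im w = -(arg x)/2, the ray through the saddle t =
√(p/x) (`norm_I_sub_integral_ray_le`). Writing t = √(p/x) e^s turns xt + p/t into 2√(px) cosh s, so
each monomial integrates exactly to a Macdonald function, and these are the terms of the scale
(`integral_ray_expansionPoly`). On the same ray the remainder is dominated by a real kernel, hence
by K_{Re a+1+N}(Re 2√(px)) (`norm_integral_ray_sub_sum_le`). In |Im Z| ≤ Re Z all Macdonald
functions have the same size e^{-Re Z}/√(Re Z) (`norm_besselK_bounds`), so this is O(φ_N). The
discarded pieces are O(e^{-ε|x|}), negligible against terms that decay no faster than exp(-B√|x|)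
(`exp_neg_isBigO_scale`).

The Hankel expansion for complex argument (`besselK_expansion`) comes from expanding cosh(μs) in the
functions cosh(s/2) sinh(s/2)^{2k}, whose integrals against e^{-Z(cosh s - 1)} are Gaussian moments.
-/

/-! ### The Macdonald integral: convergence, decay and holomorphy. -/

lemma one_add_sq_div_two_le_cosh (s : ℝ) : 1 + s ^ 2 / 2 ≤ Real.cosh s := by
  have h : Real.cosh s = 1 + 2 * Real.sinh (s / 2) ^ 2 := by
    have h1 := Real.cosh_two_mul (s / 2)
    have h2 := Real.cosh_sq (s / 2)
    rw [mul_div_cancel₀ _ (two_ne_zero)] at h1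
    linarith
  have h3 : (s / 2) ^ 2 ≤ Real.sinh (s / 2) ^ 2 := by
    rw [sq_le_sq]
    rcases le_total 0 s with hs | hs
    · have := Real.self_le_sinh_iff.2 (show 0 ≤ s / 2 by linarith)
      rwa [abs_of_nonneg (by linarith), abs_of_nonneg (by linarith)]
    · have := Real.sinh_le_self_iff.2 (show s / 2 ≤ 0 by linarith)
      rw [abs_of_nonpos (by linarith), abs_of_nonpos (by linarith)]
      linarith
  rw [h]; nlinarith

lemma integrable_exp_neg_mul_cosh {X : ℝ} (hX : 0 < X) (A : ℝ) :
    Integrable (fun s : ℝ => Real.exp (-X * Real.cosh s + A * |s|)) := by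
  have h1 := (integrable_exp_neg_mul_sq (b := X / 4) (by positivity)).const_mul
    (Real.exp (A ^ 2 / X))
  refine h1.mono' (by fun_prop) (Eventually.of_forall fun s => ?_)
  rw [Real.norm_eq_abs, Real.abs_exp, ← Real.exp_add, Real.exp_le_exp]
  have h2 := one_add_sq_div_two_le_cosh s
  have h3 : -X * Real.cosh s ≤ -X * (1 + s ^ 2 / 2) := by nlinarith
  -- Completing the square spends half of the Gaussian decay X s²/2 on the linear term.
  have h4 : A * |s| ≤ A ^ 2 / X + X / 4 * s ^ 2 := by
    have h5 : A ^ 2 / X + X / 4 * s ^ 2 - A * |s| = (A - X / 2 * |s|) ^ 2 / X := by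
      field_simp
      rw [← sq_abs s]; ring
    have : 0 ≤ (A - X / 2 * |s|) ^ 2 / X := by positivity
    linarith
  linarith

lemma norm_cexp_mul_le (μ : ℂ) (s : ℝ) : ‖Complex.exp (μ * s)‖ ≤ Real.exp (‖μ‖ * |s|) := by
  rw [Complex.norm_exp, Real.exp_le_exp]
  calc (μ * s).re ≤ ‖μ * s‖ := Complex.re_le_norm _
    _ = _ := by rw [norm_mul, Complex.norm_real, Real.norm_eq_abs]

lemma norm_ccosh_mul_le (μ : ℂ) (s : ℝ) : ‖Complex.cosh (μ * s)‖ ≤ Real.exp (‖μ‖ * |s|) := by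
  rw [Complex.cosh, norm_div]
  have h1 := norm_cexp_mul_le μ s
  have h2 := norm_cexp_mul_le (-μ) s
  rw [norm_neg, neg_mul] at h2
  have h3 := norm_add_le (Complex.exp (μ * s)) (Complex.exp (-(μ * s)))
  rw [show ‖(2 : ℂ)‖ = 2 by simp, div_le_iff₀ two_pos]
  linarith

lemma norm_cexp_neg_mul_cosh (Z : ℂ) (s : ℝ) :
    ‖Complex.exp (-Z * Complex.cosh s)‖ = Real.exp (-Z.re * Real.cosh s) := by
  rw [Complex.norm_exp, ← Complex.ofReal_cosh, Complex.re_mul_ofReal, Complex.neg_re]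

lemma integrable_cexp_kernel {Z : ℂ} (hZ : 0 < Z.re) (μ : ℂ) :
    Integrable (fun s : ℝ => Complex.exp (-Z * Complex.cosh s) * Complex.exp (μ * s)) := by
  refine (integrable_exp_neg_mul_cosh hZ ‖μ‖).mono' (by fun_prop) (Eventually.of_forall fun s => ?_)
  rw [norm_mul, norm_cexp_neg_mul_cosh, Real.exp_add]
  gcongr
  exact norm_cexp_mul_le μ s

lemma integrable_kernel {Z : ℂ} (hZ : 0 < Z.re) (μ : ℂ) :
    Integrable (fun s : ℝ => Complex.exp (-Z * Complex.cosh s) * Complex.cosh (μ * s)) := by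
  refine (integrable_exp_neg_mul_cosh hZ ‖μ‖).mono' (by fun_prop) (Eventually.of_forall fun s => ?_)
  rw [norm_mul, norm_cexp_neg_mul_cosh, Real.exp_add]
  gcongr
  exact norm_ccosh_mul_le μ s

lemma integral_cexp_kernel {Z : ℂ} (hZ : 0 < Z.re) (μ : ℂ) :
    ∫ s : ℝ, Complex.exp (-Z * Complex.cosh s) * Complex.exp (μ * s) = 2 * besselK μ Z := by
  have h := integrable_cexp_kernel hZ μ
  have h' := integrable_cexp_kernel hZ (-μ)
  rw [← intervalIntegral.integral_Iic_add_Ioi (b := 0) h.integrableOn h.integrableOn]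
  have h2 := integral_comp_neg_Ioi (0 : ℝ)
    (fun s : ℝ => Complex.exp (-Z * Complex.cosh s) * Complex.exp (μ * s))
  rw [neg_zero] at h2
  rw [← h2, besselK, ← integral_const_mul, ← integral_add]
  · refine integral_congr_ae (Eventually.of_forall fun s => ?_)
    have h3 : 2 * Complex.cosh (μ * s) = Complex.exp (μ * s) + Complex.exp (-(μ * s)) := by
      rw [Complex.cosh]; ring
    simp only [Complex.ofReal_neg, Complex.cosh_neg, mul_neg]
    rw [← mul_assoc, mul_comm 2, mul_assoc, h3]
    ring
  · refine h'.integrableOn.congr (Eventually.of_forall fun s => ?_)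
    simp only [Complex.ofReal_neg, Complex.cosh_neg, mul_neg, neg_mul]
  · exact h.integrableOn

/-- Since cosh s ≥ 1, half of the exponent Re Z · cosh s gives the decay and the other half still
makes the integral converge, uniformly in Z. -/
lemma norm_besselK_le {X₀ : ℝ} (hX₀ : 0 < X₀) (μ : ℂ) :
    ∃ C : ℝ, 0 ≤ C ∧ ∀ Z : ℂ, X₀ ≤ Z.re → ‖besselK μ Z‖ ≤ C * Real.exp (-(Z.re / 2)) := by
  refine ⟨∫ s in Set.Ioi (0 : ℝ), Real.exp (-(X₀ / 2) * Real.cosh s + ‖μ‖ * |s|),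
    integral_nonneg fun s => (Real.exp_pos _).le, fun Z hZ => ?_⟩
  rw [mul_comm, ← integral_const_mul]
  refine norm_integral_le_of_norm_le
    ((integrable_exp_neg_mul_cosh (half_pos hX₀) ‖μ‖).integrableOn.const_mul _)
    (Eventually.of_forall fun s => ?_)
  rw [norm_mul, norm_cexp_neg_mul_cosh, ← Real.exp_add, ← add_assoc, Real.exp_add]
  refine mul_le_mul (Real.exp_le_exp.2 ?_) (norm_ccosh_mul_le μ s) (norm_nonneg _)
    (Real.exp_pos _).le
  have := Real.one_le_cosh s
  nlinarith

lemma differentiableAt_besselK {Z : ℂ} (hZ : 0 < Z.re) (μ : ℂ) :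
    DifferentiableAt ℂ (besselK μ) Z := by
  have hs : {W : ℂ | Z.re / 2 < W.re} ∈ 𝓝 Z :=
    (isOpen_lt continuous_const Complex.continuous_re).mem_nhds (by simp; linarith)
  have key := hasDerivAt_integral_of_dominated_loc_of_deriv_le
    (μ := volume.restrict (Set.Ioi (0 : ℝ)))
    (F := fun (W : ℂ) (s : ℝ) => Complex.exp (-W * Complex.cosh s) * Complex.cosh (μ * s))
    (F' := fun (W : ℂ) (s : ℝ) =>
      Complex.exp (-W * Complex.cosh s) * (-1 * Complex.cosh s) * Complex.cosh (μ * s))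
    -- The extra 1 absorbs the factor cosh s produced by differentiation in Z.
    (bound := fun s => Real.exp (-(Z.re / 2) * Real.cosh s + (‖μ‖ + 1) * |s|))
    hs (Eventually.of_forall fun W => by fun_prop) (integrable_kernel hZ μ).integrableOn
    (by fun_prop) (Eventually.of_forall fun s W hW => ?_)
    (integrable_exp_neg_mul_cosh (half_pos hZ) _).integrableOn
    (Eventually.of_forall fun s W hW => ?_)
  · exact key.2.differentiableAt
  · simp only [Set.mem_ofPred_eq] at hW
    rw [norm_mul, norm_mul, norm_cexp_neg_mul_cosh, add_mul, add_comm (‖μ‖ * _), ← add_assoc,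
      Real.exp_add, Real.exp_add]
    have h1 : ‖-1 * Complex.cosh (s : ℂ)‖ ≤ Real.exp (1 * |s|) := by
      have := norm_ccosh_mul_le 1 s
      simpa using this
    refine mul_le_mul (mul_le_mul (Real.exp_le_exp.2 ?_) h1 (norm_nonneg _) (Real.exp_pos _).le)
      (norm_ccosh_mul_le μ s) (norm_nonneg _) (by positivity)
    have := Real.one_le_cosh s
    nlinarith
  · exact ((((hasDerivAt_id W).neg).mul_const _).cexp).mul_const _

/-! ### The large-argument expansion of K_μ. -/

/-- The coefficients of the large-argument expansion of `K_μ`. -/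
noncomputable def hankelCoeff (μ : ℂ) : ℕ → ℂ
  | 0 => 1
  | k + 1 => hankelCoeff μ k * (4 * μ ^ 2 - (2 * k + 1) ^ 2) / (8 * (k + 1))

lemma hankelCoeff_ofReal (ν : ℝ) (k : ℕ) : hankelCoeff ν k = besselCoeff ν k := by
  induction k with
  | zero => simp [hankelCoeff, besselCoeff]
  | succ k ih =>
    rw [hankelCoeff, ih, besselCoeff, besselCoeff, Finset.prod_Icc_succ_top (by omega),
      Nat.factorial_succ]
    have : ((k : ℂ) + 1) ≠ 0 := by exact_mod_cast k.succ_ne_zero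
    have h2 : (k.factorial : ℂ) ≠ 0 := by exact_mod_cast k.factorial_ne_zero
    push_cast
    rw [mul_add 3 k 1, pow_add]
    field_simp
    ring

/-- The coefficients of `cosh (μ s)` in the functions `cosh (s/2) sinh (s/2) ^ (2k)`. -/
noncomputable def coshCoeff (μ : ℂ) : ℕ → ℂ
  | 0 => 1
  | k + 1 => coshCoeff μ k * (μ ^ 2 - (k + 1 / 2) ^ 2) / ((k + 1) * (k + 1 / 2))

/-- Grönwall with zero initial value. The form with a factor s matters: each use gains one power of
s near 0. -/
lemma norm_le_of_hasDerivAt_linear {y f : ℝ → ℂ} {m : ℂ} {ε s : ℝ} (hs : 0 ≤ s) (hε : 0 ≤ ε)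
    (hy : ∀ t, HasDerivAt y (m * y t + f t) t) (h0 : y 0 = 0)
    (hf : ∀ t, 0 ≤ t → t ≤ s → ‖f t‖ ≤ ε) : ‖y s‖ ≤ ε * s * Real.exp (‖m‖ * s) := by
  have h := norm_le_gronwallBound_of_norm_deriv_right_le (f := y) (a := 0) (b := s) (δ := 0)
    (K := ‖m‖) (ε := ε) (fun t _ => (hy t).continuousAt.continuousWithinAt)
    (fun t _ => (hy t).hasDerivWithinAt) (by simp [h0])
    (fun t ht => (norm_add_le _ _).trans (by
      rw [norm_mul]; gcongr; exact hf t ht.1 ht.2.le)) s ⟨hs, le_rfl⟩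
  refine h.trans ?_
  rw [gronwallBound, sub_zero]
  split_ifs with hm
  · simp [hm]
  · have hm' : 0 < ‖m‖ := lt_of_le_of_ne (norm_nonneg _) (Ne.symm hm)
    have h1 := Real.add_one_le_exp (-(‖m‖ * s))
    have h2 : Real.exp (‖m‖ * s) * Real.exp (-(‖m‖ * s)) = 1 := by
      rw [← Real.exp_add]; simp
    have h3 : Real.exp (‖m‖ * s) - 1 ≤ ‖m‖ * s * Real.exp (‖m‖ * s) := by
      nlinarith [Real.exp_pos (‖m‖ * s)]
    calc _ = ε / ‖m‖ * (Real.exp (‖m‖ * s) - 1) := by ring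
      _ ≤ ε / ‖m‖ * (‖m‖ * s * Real.exp (‖m‖ * s)) := by gcongr
      _ = _ := by field_simp

/-- The basis function `cosh (s/2) sinh (s/2) ^ (2k)`. -/
noncomputable def coshBasis (k : ℕ) (s : ℝ) : ℂ :=
  Complex.cosh (s / 2) * Complex.sinh (s / 2) ^ (2 * k)

/-- The derivative of `coshBasis`. -/
noncomputable def coshBasisDeriv (k : ℕ) (s : ℝ) : ℂ :=
  (k + 1 / 2) * Complex.sinh (s / 2) ^ (2 * k + 1) + k * Complex.sinh (s / 2) ^ (2 * k - 1)

lemma hasDerivAt_sinh_half (s : ℝ) :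
    HasDerivAt (fun t : ℝ => Complex.sinh (t / 2)) (Complex.cosh (s / 2) / 2) s := by
  have h := ((Complex.hasDerivAt_sinh ((s : ℂ) / 2)).comp (s : ℂ)
    ((hasDerivAt_id (s : ℂ)).div_const 2)).comp_ofReal
  exact h.congr_deriv (by ring)

lemma hasDerivAt_cosh_half (s : ℝ) :
    HasDerivAt (fun t : ℝ => Complex.cosh (t / 2)) (Complex.sinh (s / 2) / 2) s := by
  have h := ((Complex.hasDerivAt_cosh ((s : ℂ) / 2)).comp (s : ℂ)
    ((hasDerivAt_id (s : ℂ)).div_const 2)).comp_ofReal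
  exact h.congr_deriv (by ring)

lemma hasDerivAt_coshBasis (k : ℕ) (s : ℝ) :
    HasDerivAt (coshBasis k) (coshBasisDeriv k s) s := by
  have h := (hasDerivAt_cosh_half s).mul ((hasDerivAt_sinh_half s).fun_pow (2 * k))
  have h2 := Complex.cosh_sq ((s : ℂ) / 2)
  refine h.congr_deriv ?_
  rw [coshBasisDeriv]
  rcases k with _ | k
  · simp; ring
  · rw [show 2 * (k + 1) - 1 = 2 * k + 1 by omega]
    push_cast
    linear_combination ((k : ℂ) + 1) * Complex.sinh (s / 2) ^ (2 * k + 1) * h2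

/-- The second derivative stays in the span of two neighbouring basis functions, so y'' = μ² y
becomes a two-term recursion. At k = 0 the truncated indices 2k - 1 and k - 1 are harmless, since
their coefficients vanish. -/
lemma hasDerivAt_coshBasisDeriv (k : ℕ) (s : ℝ) :
    HasDerivAt (coshBasisDeriv k)
      ((k + 1 / 2) ^ 2 * coshBasis k s + k * (k - 1 / 2) * coshBasis (k - 1) s) s := by
  have h := (((hasDerivAt_sinh_half s).fun_pow (2 * k + 1)).const_mul ((k : ℂ) + 1 / 2)).add
    (((hasDerivAt_sinh_half s).fun_pow (2 * k - 1)).const_mul (k : ℂ))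
  refine h.congr_deriv ?_
  rw [coshBasis, coshBasis]
  rcases k with _ | k
  · simp; ring
  · rw [show 2 * (k + 1) - 1 = 2 * k + 1 by omega, show k + 1 - 1 = k by omega]
    push_cast
    ring

/-- The remainder of the expansion of `cosh (μ s)`. -/
noncomputable def coshRemainder (μ : ℂ) (N : ℕ) (s : ℝ) : ℂ :=
  Complex.cosh (μ * s) - ∑ k ∈ Finset.range N, coshCoeff μ k * coshBasis k s

/-- The derivative of `coshRemainder`. -/
noncomputable def coshRemainderDeriv (μ : ℂ) (N : ℕ) (s : ℝ) : ℂ :=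
  μ * Complex.sinh (μ * s) - ∑ k ∈ Finset.range N, coshCoeff μ k * coshBasisDeriv k s

lemma hasDerivAt_coshRemainder (μ : ℂ) (N : ℕ) (s : ℝ) :
    HasDerivAt (coshRemainder μ N) (coshRemainderDeriv μ N s) s := by
  have h1 := ((Complex.hasDerivAt_cosh (μ * s)).comp (s : ℂ)
    ((hasDerivAt_id (s : ℂ)).const_mul μ)).comp_ofReal
  have h2 := HasDerivAt.fun_sum (u := Finset.range N)
    (fun k _ => (hasDerivAt_coshBasis k s).const_mul (coshCoeff μ k))
  refine (h1.sub h2).congr_deriv ?_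
  rw [coshRemainderDeriv]; ring

/-- The recursion for `coshCoeff` makes the full series a formal solution of y'' = μ² y; truncation
leaves a single boundary term. -/
lemma sum_coshCoeff_ode (μ : ℂ) (N : ℕ) (s : ℝ) :
    ∑ k ∈ Finset.range N, coshCoeff μ k *
      ((k + 1 / 2) ^ 2 * coshBasis k s + k * (k - 1 / 2) * coshBasis (k - 1) s)
    = μ ^ 2 * ∑ k ∈ Finset.range N, coshCoeff μ k * coshBasis k s
      - N * (N - 1 / 2) * coshCoeff μ N * coshBasis (N - 1) s := by
  induction N with
  | zero => simp
  | succ N ih =>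
    have h1 : ((N : ℂ) + 1) ≠ 0 := by exact_mod_cast N.succ_ne_zero
    have h2 : ((N : ℂ) + 1 / 2) ≠ 0 := by
      intro h
      have := congrArg Complex.re h
      simp at this
      have h3 : (0 : ℝ) ≤ N := N.cast_nonneg
      linarith
    rw [Finset.sum_range_succ, ih, Finset.sum_range_succ, coshCoeff, Nat.add_sub_cancel]
    have h3 : ((N : ℂ) + 1) * (N + 1 - 1 / 2) *
        (coshCoeff μ N * (μ ^ 2 - (N + 1 / 2) ^ 2) / ((N + 1) * (N + 1 / 2)))
        = coshCoeff μ N * (μ ^ 2 - (N + 1 / 2) ^ 2) := by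
      rw [show (N : ℂ) + 1 - 1 / 2 = N + 1 / 2 by ring, mul_div_cancel₀ _ (mul_ne_zero h1 h2)]
    push_cast
    rw [h3]
    ring

lemma hasDerivAt_coshRemainderDeriv (μ : ℂ) (N : ℕ) (s : ℝ) :
    HasDerivAt (coshRemainderDeriv μ N) (μ ^ 2 * coshRemainder μ N s
      + N * (N - 1 / 2) * coshCoeff μ N * coshBasis (N - 1) s) s := by
  have h1 := (((Complex.hasDerivAt_sinh (μ * s)).comp (s : ℂ)
    ((hasDerivAt_id (s : ℂ)).const_mul μ)).comp_ofReal).const_mul μ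
  have h2 := HasDerivAt.fun_sum (u := Finset.range N)
    (fun k _ => (hasDerivAt_coshBasisDeriv k s).const_mul (coshCoeff μ k))
  refine (h1.sub h2).congr_deriv ?_
  rw [sum_coshCoeff_ode, coshRemainder]
  ring

lemma sinh_half_le {s : ℝ} (hs : 0 ≤ s) : Real.sinh (s / 2) ≤ s * Real.exp s := by
  have h1 := Real.add_one_le_exp (-s)
  have h2 : Real.exp (-(s / 2)) = Real.exp (s / 2) * Real.exp (-s) := by
    rw [← Real.exp_add]; ring_nf
  have h3 : Real.exp (s / 2) ≤ Real.exp s := Real.exp_le_exp.2 (by linarith)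
  have h4 := Real.exp_pos (s / 2)
  rw [Real.sinh_eq, h2]
  nlinarith

lemma cosh_half_le {s : ℝ} (hs : 0 ≤ s) : Real.cosh (s / 2) ≤ Real.exp s := by
  have h1 : Real.exp (-(s / 2)) ≤ Real.exp s := Real.exp_le_exp.2 (by linarith)
  have h3 : Real.exp (s / 2) ≤ Real.exp s := Real.exp_le_exp.2 (by linarith)
  rw [Real.cosh_eq]
  linarith

lemma norm_coshBasis (k : ℕ) {s : ℝ} (hs : 0 ≤ s) :
    ‖coshBasis k s‖ = Real.cosh (s / 2) * Real.sinh (s / 2) ^ (2 * k) := by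
  have h1 : (s : ℂ) / 2 = ((s / 2 : ℝ) : ℂ) := by push_cast; rfl
  have h2 := (Real.cosh_pos (s / 2)).le
  have h3 := Real.sinh_nonneg_iff.2 (show 0 ≤ s / 2 by linarith)
  rw [coshBasis, h1, ← Complex.ofReal_cosh, ← Complex.ofReal_sinh, norm_mul, norm_pow,
    Complex.norm_real, Complex.norm_real, Real.norm_of_nonneg h2, Real.norm_of_nonneg h3]

lemma norm_coshBasis_le (k : ℕ) {s : ℝ} (hs : 0 ≤ s) :
    ‖coshBasis k s‖ ≤ s ^ (2 * k) * Real.exp ((2 * k + 1) * s) := by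
  have h3 := Real.sinh_nonneg_iff.2 (show 0 ≤ s / 2 by linarith)
  rw [norm_coshBasis k hs]
  calc _ ≤ Real.exp s * (s * Real.exp s) ^ (2 * k) := by
        gcongr
        · exact cosh_half_le hs
        · exact sinh_half_le hs
    _ = _ := by
        rw [mul_pow, ← Real.exp_nat_mul, add_mul, Real.exp_add]
        push_cast
        ring_nf

/-- The remainder R solves R'' - μ² R = O(s^{2N-2}) near 0 with zero initial data. Factoring the
operator as (d/ds - μ)(d/ds + μ) reduces this to two first-order equations, and each gains one power
of s. -/
lemma norm_coshRemainder_le (μ : ℂ) (N : ℕ) :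
    ∃ C B : ℝ, 0 ≤ C ∧ 0 ≤ B ∧ ∀ s : ℝ, 0 ≤ s →
      ‖coshRemainder μ N s‖ ≤ C * (s ^ (2 * N) * Real.exp (B * s)) := by
  rcases N with _ | M
  · refine ⟨1, ‖μ‖, zero_le_one, norm_nonneg _, fun s hs => ?_⟩
    have := norm_ccosh_mul_le μ s
    rw [abs_of_nonneg hs] at this
    simpa [coshRemainder] using this
  set N := M + 1 with hN
  set K : ℂ := N * (N - 1 / 2) * coshCoeff μ N with hK
  refine ⟨‖K‖, 2 * M + 1 + ‖μ‖ + ‖μ‖, norm_nonneg _, by positivity, fun s hs => ?_⟩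
  -- A = R' + μR satisfies A' = μA + forcing, and then R' = -μR + A.
  set A : ℝ → ℂ := fun t => coshRemainderDeriv μ N t + μ * coshRemainder μ N t with hA
  have hb0 : ∀ k, coshBasis k 0 = if k = 0 then 1 else 0 := by
    intro k; rcases k with _ | k <;> simp [coshBasis]
  have hR0 : coshRemainder μ N 0 = 0 := by
    simp [coshRemainder, hb0, hN, coshCoeff, Finset.sum_ite_eq']
  have hd0 : ∀ k, coshBasisDeriv k 0 = 0 := by
    intro k
    rcases k with _ | k
    · simp [coshBasisDeriv]
    · rw [coshBasisDeriv, show 2 * (k + 1) - 1 = 2 * k + 1 by omega]; simp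
  have hD0 : coshRemainderDeriv μ N 0 = 0 := by
    simp [coshRemainderDeriv, hd0]
  have hA0 : A 0 = 0 := by simp [hA, hR0, hD0]
  have hAd : ∀ t, HasDerivAt A (μ * A t + K * coshBasis M t) t := fun t => by
    refine ((hasDerivAt_coshRemainderDeriv μ N t).add
      ((hasDerivAt_coshRemainder μ N t).const_mul μ)).congr_deriv ?_
    simp only [hA, hK, hN, Nat.add_sub_cancel]
    ring
  have hRd : ∀ t, HasDerivAt (coshRemainder μ N) (-μ * coshRemainder μ N t + A t) t := fun t => by
    refine (hasDerivAt_coshRemainder μ N t).congr_deriv ?_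
    simp only [hA]; ring
  set ε := ‖K‖ * (s ^ (2 * M) * Real.exp ((2 * M + 1) * s)) with hε
  have hAb : ∀ t, 0 ≤ t → t ≤ s → ‖A t‖ ≤ ε * s * Real.exp (‖μ‖ * s) := fun t ht hts => by
    refine (norm_le_of_hasDerivAt_linear ht (ε := ε) (by positivity) hAd hA0
      fun u hu hut => ?_).trans (by gcongr)
    rw [norm_mul, hε]
    gcongr
    refine (norm_coshBasis_le M hu).trans ?_
    have := hut.trans hts
    gcongr
  have h := norm_le_of_hasDerivAt_linear hs (by positivity) hRd hR0 hAb
  refine h.trans (le_of_eq ?_)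
  rw [norm_neg, hε, hN, add_mul _ ‖μ‖, add_mul _ ‖μ‖, Real.exp_add, Real.exp_add]
  ring

lemma norm_cexp_neg_mul_cosh_sub_one (Z : ℂ) (s : ℝ) :
    ‖Complex.exp (-Z * (Complex.cosh s - 1))‖ = Real.exp (-Z.re * (Real.cosh s - 1)) := by
  rw [Complex.norm_exp, ← Complex.ofReal_cosh, ← Complex.ofReal_one, ← Complex.ofReal_sub,
    Complex.re_mul_ofReal, Complex.neg_re]

lemma integrableOn_of_norm_le_exp {Z : ℂ} (hZ : 0 < Z.re) {f : ℝ → ℂ} (hf : Continuous f)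
    {C B : ℝ} (h : ∀ s, 0 ≤ s → ‖f s‖ ≤ C * Real.exp (B * s)) :
    IntegrableOn (fun s : ℝ => Complex.exp (-Z * (Complex.cosh s - 1)) * f s) (Set.Ioi 0) := by
  refine (((integrable_exp_neg_mul_cosh hZ B).const_mul (C * Real.exp Z.re)).integrableOn
    (s := Set.Ioi 0)).mono' (by fun_prop) ?_
  filter_upwards [ae_restrict_mem measurableSet_Ioi] with s hs
  have hs' : (0 : ℝ) ≤ s := le_of_lt hs
  rw [norm_mul, norm_cexp_neg_mul_cosh_sub_one, abs_of_nonneg hs',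
    show -Z.re * (Real.cosh s - 1) = Z.re + -Z.re * Real.cosh s by ring, Real.exp_add,
    Real.exp_add]
  calc _ ≤ Real.exp Z.re * Real.exp (-Z.re * Real.cosh s) * (C * Real.exp (B * s)) := by
        gcongr; exact h s hs'
    _ = _ := by ring

lemma continuous_coshBasis (k : ℕ) : Continuous (coshBasis k) := by
  unfold coshBasis; fun_prop

lemma continuous_coshRemainder (μ : ℂ) (N : ℕ) : Continuous (coshRemainder μ N) := by
  have := continuous_coshBasis
  unfold coshRemainder; fun_prop

lemma pow_le_exp_mul (n : ℕ) {s : ℝ} (hs : 0 ≤ s) : s ^ n ≤ n.factorial * Real.exp s := by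
  have := Real.pow_div_factorial_le_exp s hs n
  rwa [div_le_iff₀' (by positivity)] at this

lemma norm_pow_mul_exp_le {f : ℝ → ℂ} {C B : ℝ} (hC : 0 ≤ C) (n : ℕ)
    (h : ∀ s : ℝ, 0 ≤ s → ‖f s‖ ≤ C * (s ^ n * Real.exp (B * s))) (s : ℝ) (hs : 0 ≤ s) :
    ‖f s‖ ≤ C * n.factorial * Real.exp ((1 + B) * s) := by
  refine (h s hs).trans ?_
  rw [add_mul, Real.exp_add, one_mul, mul_assoc, ← mul_assoc (n.factorial : ℝ)]
  gcongr
  exact pow_le_exp_mul n hs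

lemma integrableOn_kernel_coshBasis {Z : ℂ} (hZ : 0 < Z.re) (k : ℕ) :
    IntegrableOn (fun s : ℝ => Complex.exp (-Z * (Complex.cosh s - 1)) * coshBasis k s)
      (Set.Ioi 0) :=
  integrableOn_of_norm_le_exp hZ (continuous_coshBasis k)
    (norm_pow_mul_exp_le zero_le_one (2 * k)
      (fun s hs => by rw [one_mul]; exact norm_coshBasis_le k hs))

lemma integrableOn_kernel_coshRemainder {Z : ℂ} (hZ : 0 < Z.re) (μ : ℂ) (N : ℕ) :
    IntegrableOn (fun s : ℝ => Complex.exp (-Z * (Complex.cosh s - 1)) * coshRemainder μ N s)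
      (Set.Ioi 0) := by
  obtain ⟨C, B, hC, _, h⟩ := norm_coshRemainder_le μ N
  exact integrableOn_of_norm_le_exp hZ (continuous_coshRemainder μ N)
    (norm_pow_mul_exp_le hC (2 * N) h)

lemma cosh_eq_one_add_two_sinh_half_sq (s : ℂ) :
    Complex.cosh s - 1 = 2 * Complex.sinh (s / 2) ^ 2 := by
  have h1 := Complex.cosh_two_mul (s / 2)
  have h2 := Complex.cosh_sq (s / 2)
  rw [mul_div_cancel₀ _ (two_ne_zero)] at h1
  rw [h1, h2]; ring

/-- Under q = sinh(s/2) the exponent is -2Z q² and cosh(s/2) ds = 2 dq, which leaves a half-line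
Gaussian. This is why the basis carries the factor cosh(s/2). -/
lemma integral_kernel_coshBasis_zero {Z : ℂ} (hZ : 0 < Z.re) :
    ∫ s in Set.Ioi (0 : ℝ), Complex.exp (-Z * (Complex.cosh s - 1)) * coshBasis 0 s
      = (Real.pi / (2 * Z)) ^ (1 / 2 : ℂ) := by
  have himg : (fun s : ℝ => Real.sinh (s / 2)) '' Set.Ioi 0 = Set.Ioi 0 := by
    ext y
    constructor
    · rintro ⟨s, hs, rfl⟩
      exact Real.sinh_pos_iff.2 (half_pos hs)
    · intro hy
      refine ⟨2 * Real.arsinh y, ?_, by simp⟩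
      have := Real.arsinh_pos_iff.2 hy
      simp only [Set.mem_Ioi]; linarith
  have hd : ∀ s ∈ Set.Ioi (0 : ℝ), HasDerivWithinAt (fun s : ℝ => Real.sinh (s / 2))
      (Real.cosh (s / 2) * (1 / 2)) (Set.Ioi 0) s := fun s _ =>
    ((hasDerivAt_id s).div_const 2).sinh.hasDerivWithinAt
  have hinj : Set.InjOn (fun s : ℝ => Real.sinh (s / 2)) (Set.Ioi 0) := fun x _ y _ hxy => by
    have := Real.sinh_injective hxy; linarith
  have h := integral_image_eq_integral_abs_deriv_smul measurableSet_Ioi hd hinj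
    (fun q : ℝ => Complex.exp (-(2 * Z) * q ^ 2))
  have hg := integral_gaussian_complex_Ioi (b := 2 * Z) (by simpa using hZ)
  rw [himg, hg] at h
  rw [← mul_div_cancel₀ ((Real.pi / (2 * Z)) ^ (1 / 2 : ℂ)) (two_ne_zero (α := ℂ)), h, ← integral_const_mul]
  refine integral_congr_ae (Eventually.of_forall fun s => ?_)
  have hc := Real.cosh_pos (s / 2)
  simp only [coshBasis, mul_zero, pow_zero, mul_one, Complex.real_smul]
  rw [abs_of_pos (by positivity), cosh_eq_one_add_two_sinh_half_sq]
  push_cast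
  ring_nf

/-- The recursion for Gaussian moments: integrate the derivative of e^{-Z(cosh s - 1)}
sinh(s/2)^{2k+1} over the half-line. -/
lemma integral_kernel_coshBasis_succ {Z : ℂ} (hZ : 0 < Z.re) (k : ℕ) :
    ∫ s in Set.Ioi (0 : ℝ), Complex.exp (-Z * (Complex.cosh s - 1)) * coshBasis (k + 1) s
      = (2 * k + 1) / (4 * Z) *
        ∫ s in Set.Ioi (0 : ℝ), Complex.exp (-Z * (Complex.cosh s - 1)) * coshBasis k s := by
  have hZ0 : Z ≠ 0 := by rintro rfl; simp at hZ
  set F : ℝ → ℂ := fun s =>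
    Complex.exp (-Z * (Complex.cosh s - 1)) * Complex.sinh (s / 2) ^ (2 * k + 1) with hF
  set F' : ℝ → ℂ := fun s =>
    (k + 1 / 2) * (Complex.exp (-Z * (Complex.cosh s - 1)) * coshBasis k s)
      - 2 * Z * (Complex.exp (-Z * (Complex.cosh s - 1)) * coshBasis (k + 1) s) with hF'
  have hd : ∀ s : ℝ, HasDerivAt F (F' s) s := fun s => by
    have h1 := (((Complex.hasDerivAt_cosh (s : ℂ)).sub_const 1).const_mul (-Z)).cexp.comp_ofReal
    refine (h1.mul ((hasDerivAt_sinh_half s).fun_pow (2 * k + 1))).congr_deriv ?_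
    have h2 : Complex.sinh (s : ℂ) = 2 * Complex.sinh (s / 2) * Complex.cosh (s / 2) := by
      rw [← Complex.sinh_two_mul, mul_div_cancel₀ _ (two_ne_zero)]
    simp only [hF', coshBasis, h2]
    push_cast
    ring
  have hFi : IntegrableOn F (Set.Ioi 0) := by
    refine integrableOn_of_norm_le_exp hZ (by fun_prop)
      (norm_pow_mul_exp_le (B := 2 * k + 1) zero_le_one (2 * k + 1) fun s hs => ?_)
    have h1 : (s : ℂ) / 2 = ((s / 2 : ℝ) : ℂ) := by push_cast; rfl
    have h3 := Real.sinh_nonneg_iff.2 (show 0 ≤ s / 2 by linarith)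
    rw [h1, ← Complex.ofReal_sinh, norm_pow, Complex.norm_real, Real.norm_of_nonneg h3, one_mul]
    calc _ ≤ (s * Real.exp s) ^ (2 * k + 1) := by gcongr; exact sinh_half_le hs
      _ = _ := by rw [mul_pow, ← Real.exp_nat_mul]; push_cast; rfl
  have hi1 := (integrableOn_kernel_coshBasis hZ k).const_mul ((k : ℂ) + 1 / 2)
  have hi2 := (integrableOn_kernel_coshBasis hZ (k + 1)).const_mul (2 * Z)
  -- Both F and F' are integrable, so the boundary term at infinity vanishes.
  have hlim := tendsto_zero_of_hasDerivAt_of_integrableOn_Ioi (fun s _ => hd s) (hi1.sub hi2) hFi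
  have h := integral_Ioi_of_hasDerivAt_of_tendsto (hd 0).continuousAt.continuousWithinAt
    (fun s _ => hd s) (hi1.sub hi2) hlim
  have hF0 : F 0 = 0 := by simp [hF]
  rw [hF0, sub_zero, hF', integral_sub hi1 hi2, integral_const_mul, integral_const_mul,
    sub_eq_zero] at h
  rw [div_mul_eq_mul_div, eq_div_iff (mul_ne_zero (by norm_num) hZ0)]
  linear_combination (-2) * h

lemma coshCoeff_mul_integral {Z : ℂ} (hZ : 0 < Z.re) (μ : ℂ) (k : ℕ) :
    coshCoeff μ k *
      ∫ s in Set.Ioi (0 : ℝ), Complex.exp (-Z * (Complex.cosh s - 1)) * coshBasis k s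
      = (Real.pi / (2 * Z)) ^ (1 / 2 : ℂ) * (hankelCoeff μ k * (1 / Z) ^ k) := by
  have hZ0 : Z ≠ 0 := by rintro rfl; simp at hZ
  induction k with
  | zero => rw [integral_kernel_coshBasis_zero hZ]; simp [coshCoeff, hankelCoeff]
  | succ k ih =>
    have h1 : ((k : ℂ) + 1) ≠ 0 := by exact_mod_cast k.succ_ne_zero
    have h2 : (2 * (k : ℂ) + 1) ≠ 0 := by exact_mod_cast (2 * k).succ_ne_zero
    have h3 : ((k : ℂ) + 1 / 2) = (2 * k + 1) / 2 := by ring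
    rw [integral_kernel_coshBasis_succ hZ, coshCoeff, hankelCoeff, h3]
    have e1 : ∀ J : ℂ, coshCoeff μ k * (μ ^ 2 - ((2 * k + 1) / 2) ^ 2) / ((k + 1) * ((2 * k + 1) / 2))
        * ((2 * k + 1) / (4 * Z) * J) = (4 * μ ^ 2 - (2 * k + 1) ^ 2) / (8 * (k + 1)) / Z
          * (coshCoeff μ k * J) := fun J => by
      field_simp
      ring
    rw [e1, ih, pow_succ]
    ring

/-- Watson's lemma by rescaling: s ↦ s√(Re Z) extracts (Re Z)^{-N-1/2} and leaves a fixed Gaussian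
integral. -/
lemma integral_kernel_remainder_le {C B : ℝ} (hC : 0 ≤ C) (hB : 0 ≤ B) (N : ℕ) :
    ∃ C' : ℝ, 0 ≤ C' ∧ ∀ (Z : ℂ) (R : ℝ → ℂ), 1 ≤ Z.re →
      (∀ s : ℝ, 0 ≤ s → ‖R s‖ ≤ C * (s ^ (2 * N) * Real.exp (B * s))) →
      ‖∫ s in Set.Ioi (0 : ℝ), Complex.exp (-Z * (Complex.cosh s - 1)) * R s‖
        ≤ C' * (1 / Z.re) ^ N * (1 / √Z.re) := by
  set g : ℝ → ℝ := fun s => Real.exp (-(s ^ 2 / 2)) * (s ^ (2 * N) * Real.exp (B * s)) with hg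
  have hgi : IntegrableOn g (Set.Ioi 0) := by
    have h1 := ((integrable_exp_neg_mul_sq (b := 1 / 4) (by norm_num)).const_mul
      ((2 * N).factorial * Real.exp ((1 + B) ^ 2))).integrableOn (s := Set.Ioi 0)
    refine h1.mono' (by fun_prop) ?_
    filter_upwards [ae_restrict_mem measurableSet_Ioi] with s hs
    have hs' : (0 : ℝ) ≤ s := le_of_lt hs
    rw [Real.norm_of_nonneg (by positivity)]
    calc g s ≤ Real.exp (-(s ^ 2 / 2)) *
          ((2 * N).factorial * Real.exp s * Real.exp (B * s)) := by
          simp only [hg]; gcongr; exact pow_le_exp_mul _ hs'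
      _ = (2 * N).factorial * Real.exp (-(s ^ 2 / 2) + (s + B * s)) := by
          rw [Real.exp_add, Real.exp_add]; ring
      _ ≤ (2 * N).factorial * Real.exp ((1 + B) ^ 2 + -(1 / 4) * s ^ 2) := by
          refine mul_le_mul_of_nonneg_left (Real.exp_le_exp.2 ?_) (by positivity)
          nlinarith [sq_nonneg (s / 2 - (1 + B))]
      _ = _ := by rw [Real.exp_add]; ring
  refine ⟨C * ∫ s in Set.Ioi (0 : ℝ), g s, mul_nonneg hC
    (setIntegral_nonneg measurableSet_Ioi fun s hs => ?_), fun Z R hZ hR => ?_⟩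
  · have : (0 : ℝ) ≤ s := le_of_lt hs
    positivity
  set X := Z.re with hX
  have hX0 : 0 < X := by linarith
  set b := √X with hb
  -- This gives e^{Bs} ≤ e^{Bbs}, so the growth factor survives the rescaling uniformly in Z.
  have hb1 : 1 ≤ b := Real.one_le_sqrt.2 hZ
  have hb2 : b ^ 2 = X := Real.sq_sqrt hX0.le
  have hb0 : 0 < b := by linarith
  have hcomp := integral_comp_mul_left_Ioi g 0 hb0
  rw [mul_zero] at hcomp
  have hgi' : IntegrableOn (fun s => g (b * s)) (Set.Ioi 0) := by
    rw [integrableOn_Ioi_comp_mul_left_iff g 0 hb0, mul_zero]; exact hgi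
  calc _ ≤ ∫ s in Set.Ioi (0 : ℝ), C * (1 / X) ^ N * g (b * s) := by
        refine norm_integral_le_of_norm_le (hgi'.const_mul _) ?_
        filter_upwards [ae_restrict_mem measurableSet_Ioi] with s hs
        have hs' : (0 : ℝ) ≤ s := le_of_lt hs
        rw [norm_mul, norm_cexp_neg_mul_cosh_sub_one, ← hX]
        have h1 := one_add_sq_div_two_le_cosh s
        have h2 : (1 / X) ^ N * (b * s) ^ (2 * N) = s ^ (2 * N) := by
          rw [mul_pow, pow_mul b, hb2, ← mul_assoc, ← mul_pow, one_div_mul_cancel hX0.ne', one_pow,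
            one_mul]
        calc _ ≤ Real.exp (-((b * s) ^ 2 / 2)) *
              (C * (s ^ (2 * N) * Real.exp (B * (b * s)))) := by
              refine mul_le_mul (Real.exp_le_exp.2 ?_) ((hR s hs').trans ?_) (norm_nonneg _)
                (Real.exp_pos _).le
              · rw [mul_pow, hb2]; nlinarith
              · gcongr
                nlinarith
          _ = _ := by
              rw [← h2]; simp only [hg]; ring
    _ = _ := by
        rw [integral_const_mul, hcomp, smul_eq_mul]
        ring

/-- The large-argument expansion of `K_μ`, with a remainder uniform in `Re Z ≥ 1`. -/
lemma besselK_expansion (μ : ℂ) (N : ℕ) :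
    ∃ C : ℝ, 0 ≤ C ∧ ∀ Z : ℂ, 1 ≤ Z.re →
      ‖Complex.exp Z * besselK μ Z - (Real.pi / (2 * Z)) ^ (1 / 2 : ℂ) *
        ∑ k ∈ Finset.range N, hankelCoeff μ k * (1 / Z) ^ k‖
        ≤ C * (1 / Z.re) ^ N * (1 / √Z.re) := by
  obtain ⟨C, B, hC, hB, h⟩ := norm_coshRemainder_le μ N
  obtain ⟨C', hC', h'⟩ := integral_kernel_remainder_le hC hB N
  refine ⟨C', hC', fun Z hZ => ?_⟩
  have hZ0 : 0 < Z.re := by linarith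
  convert h' Z (coshRemainder μ N) hZ h using 2
  rw [sub_eq_iff_eq_add, besselK, ← integral_const_mul, Finset.mul_sum]
  simp only [← coshCoeff_mul_integral hZ0, ← integral_const_mul]
  rw [← integral_finsetSum, ← integral_add (integrableOn_kernel_coshRemainder hZ0 μ N)]
  · refine integral_congr_ae (Eventually.of_forall fun s => ?_)
    simp only [coshRemainder]
    rw [mul_sub (Complex.exp _) (Complex.cosh _), Finset.mul_sum, ← mul_assoc, ← Complex.exp_add]
    have : ∀ k, Complex.exp (-Z * (Complex.cosh s - 1)) * (coshCoeff μ k * coshBasis k s)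
      = coshCoeff μ k * (Complex.exp (-Z * (Complex.cosh s - 1)) * coshBasis k s) := fun k => by ring
    simp only [this]
    rw [sub_add_cancel]
    congr 2
    ring
  · exact integrable_finsetSum _ fun k _ => (integrableOn_kernel_coshBasis hZ0 k).const_mul _
  · exact fun k _ => (integrableOn_kernel_coshBasis hZ0 k).const_mul _

/-! ### Size of K_μ in the sector |Im Z| ≤ Re Z. -/

lemma norm_le_two_mul_re {z : ℂ} (h : |z.im| ≤ z.re) : ‖z‖ ≤ 2 * z.re :=
  (Complex.norm_le_abs_re_add_abs_im z).trans (by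
    rw [abs_of_nonneg ((abs_nonneg _).trans h)]; linarith)

lemma norm_cpow_half (z : ℂ) : ‖z ^ (1 / 2 : ℂ)‖ = √‖z‖ := by
  rw [show (1 / 2 : ℂ) = ((1 / 2 : ℝ) : ℂ) by push_cast; rfl, Complex.norm_cpow_real,
    Real.sqrt_eq_rpow]

/-- Two-sided bounds for `K_μ` in the sector `|Im Z| ≤ Re Z`. -/
lemma norm_besselK_bounds (μ : ℂ) :
    ∃ C X₀ : ℝ, 0 < C ∧ 0 < X₀ ∧ ∀ Z : ℂ, |Z.im| ≤ Z.re → X₀ ≤ Z.re →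
      Real.exp (-Z.re) / √Z.re ≤ C * ‖besselK μ Z‖ ∧
      ‖besselK μ Z‖ ≤ C * (Real.exp (-Z.re) / √Z.re) := by
  obtain ⟨C, hC, h⟩ := besselK_expansion μ 1
  -- In units of (Re Z)^{-1/2} the leading term of e^Z K_μ(Z) lies between 1/2 and 2; Re Z ≥ 4C + 1
  -- makes the error at most 1/4.
  refine ⟨4 + C, 4 * C + 1, by positivity, by positivity, fun Z hZ hX => ?_⟩
  have h1 : 1 ≤ Z.re := by linarith
  have h0 : 0 < Z.re := by linarith
  have hn := norm_le_two_mul_re hZ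
  have hn' := Complex.re_le_norm Z
  have hn0 : 0 < ‖Z‖ := by linarith
  have hs0 : 0 < √Z.re := Real.sqrt_pos.2 h0
  specialize h Z h1
  simp only [Finset.sum_range_one, hankelCoeff, pow_zero, pow_one, mul_one] at h
  have hexp : ‖Complex.exp Z * besselK μ Z‖ = Real.exp Z.re * ‖besselK μ Z‖ := by
    rw [norm_mul, Complex.norm_exp]
  have hm : ‖(Real.pi / (2 * Z)) ^ (1 / 2 : ℂ)‖ = √(Real.pi / (2 * ‖Z‖)) := by
    rw [norm_cpow_half]
    simp [Real.pi_pos.le, abs_of_nonneg]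
  have hlow : 1 / 2 * (1 / √Z.re) ≤ √(Real.pi / (2 * ‖Z‖)) := by
    refine Real.le_sqrt_of_sq_le ?_
    rw [mul_pow, div_pow, div_pow, Real.sq_sqrt h0.le, div_mul_div_comm,
      div_le_div_iff₀ (by positivity) (by positivity)]
    nlinarith [Real.pi_gt_three]
  have hup : √(Real.pi / (2 * ‖Z‖)) ≤ 2 * (1 / √Z.re) := by
    refine Real.sqrt_le_iff.2 ⟨by positivity, ?_⟩
    rw [mul_pow, div_pow, Real.sq_sqrt h0.le, mul_div_assoc',
      div_le_div_iff₀ (by positivity) (by positivity)]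
    nlinarith [Real.pi_lt_four]
  have hq : C * (1 / Z.re) ≤ 1 / 4 := by
    rw [mul_one_div, div_le_div_iff₀ h0 (by norm_num)]; linarith
  have hr : C * (1 / Z.re) * (1 / √Z.re) ≤ 1 / 4 * (1 / √Z.re) := by gcongr
  have t1 := norm_sub_norm_le ((Real.pi / (2 * Z)) ^ (1 / 2 : ℂ)) (Complex.exp Z * besselK μ Z)
  have t2 := norm_sub_norm_le (Complex.exp Z * besselK μ Z) ((Real.pi / (2 * Z)) ^ (1 / 2 : ℂ))
  rw [norm_sub_rev, hexp, hm] at t1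
  rw [hexp, hm] at t2
  have hp1 : 0 < 1 / √Z.re := by positivity
  have he : Real.exp (-Z.re) * Real.exp Z.re = 1 := by rw [← Real.exp_add]; simp
  have hK : ‖besselK μ Z‖ = Real.exp (-Z.re) * (Real.exp Z.re * ‖besselK μ Z‖) := by
    rw [← mul_assoc, he, one_mul]
  have hpos := Real.exp_pos (-Z.re)
  have l1 : 1 / √Z.re ≤ (4 + C) * (Real.exp Z.re * ‖besselK μ Z‖) := by
    have : 0 ≤ Real.exp Z.re * ‖besselK μ Z‖ := by positivity
    nlinarith
  have l2 : Real.exp Z.re * ‖besselK μ Z‖ ≤ (4 + C) * (1 / √Z.re) := by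
    nlinarith
  constructor
  · rw [hK, div_eq_mul_one_div]
    calc _ ≤ Real.exp (-Z.re) * ((4 + C) * (Real.exp Z.re * ‖besselK μ Z‖)) := by gcongr
      _ = _ := by ring
  · rw [hK, div_eq_mul_one_div]
    calc _ ≤ Real.exp (-Z.re) * ((4 + C) * (1 / √Z.re)) := by gcongr
      _ = _ := by ring

/-! ### The amplitude near t = 0. -/

/-- The sector `|arg t| ≤ π/4`, without its vertex. -/
def quarterSector : Set ℂ := {t | |t.im| ≤ t.re ∧ t ≠ 0}

lemma re_pos_of_mem {t : ℂ} (ht : t ∈ quarterSector) : 0 < t.re := by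
  obtain ⟨h1, h2⟩ := ht
  refine lt_of_le_of_ne ((abs_nonneg _).trans h1) fun h => h2 ?_
  rw [← h] at h1
  exact Complex.ext h.symm (abs_nonpos_iff.1 h1)

lemma re_inv_ge {t : ℂ} (ht : t ∈ quarterSector) : 1 / (2 * ‖t‖) ≤ (1 / t).re := by
  have h0 := re_pos_of_mem ht
  have hn : 0 < ‖t‖ := norm_pos_iff.2 ht.2
  have hn' := norm_le_two_mul_re ht.1
  rw [one_div t, Complex.inv_re, Complex.normSq_eq_norm_sq, div_le_div_iff₀ (by positivity)
    (by positivity)]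
  nlinarith

lemma one_sub_ne_zero_of_norm {t : ℂ} (h : ‖t‖ ≤ 1 / 2) : 1 - t ≠ 0 := by
  intro h1
  rw [← sub_eq_zero.1 h1] at h
  norm_num at h

lemma re_one_sub_pos {t : ℂ} (h : ‖t‖ ≤ 1 / 2) : 0 < (1 - t).re := by
  have := Complex.re_le_norm t
  simp only [Complex.sub_re, Complex.one_re]
  linarith

/-- Separates the essential singularity at t = 0 from a part analytic there. -/
lemma argument_eq (p : ℝ) {t : ℂ} (h0 : t ≠ 0) (h1 : 1 - t ≠ 0) :
    (p : ℂ) / (t * (1 - t)) = p * (1 / t) + p / (1 - t) := by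
  field_simp
  ring

lemma re_inv_one_sub_pos {t : ℂ} (h : ‖t‖ ≤ 1 / 2) : 0 < (1 / (1 - t)).re := by
  have h1 := re_one_sub_pos h
  rw [one_div, Complex.inv_re]
  exact div_pos h1 (Complex.normSq_pos.2 (one_sub_ne_zero_of_norm h))

lemma re_argument_ge {p : ℝ} (hp : 0 < p) {t : ℂ} (ht : t ∈ quarterSector) (h : ‖t‖ ≤ 1 / 2) :
    p * (1 / (2 * ‖t‖)) ≤ ((p : ℂ) / (t * (1 - t))).re := by
  rw [argument_eq p ht.2 (one_sub_ne_zero_of_norm h), Complex.add_re, Complex.re_ofReal_mul,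
    div_eq_mul_one_div (p : ℂ), Complex.re_ofReal_mul]
  have h1 := mul_le_mul_of_nonneg_left (re_inv_ge ht) hp.le
  have h2 := mul_pos hp (re_inv_one_sub_pos h)
  linarith

/-- The factor `√(2p/π) (1-t)^{b-1/2} K_ν(p/(t(1-t)))` of the integrand. -/
noncomputable def amplitude (p ν : ℝ) (b t : ℂ) : ℂ :=
  (Real.sqrt (2 * p / Real.pi) : ℂ) * (1 - t) ^ (b - 1 / 2) * besselK ν (p / (t * (1 - t)))

/-- `(1-w)^{b+k} e^{-pw/(1-w)}`. -/
noncomputable def generating (p : ℝ) (b : ℂ) (k : ℕ) (w : ℂ) : ℂ :=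
  (1 - w) ^ (b + (k : ℂ)) * Complex.exp (-((p : ℂ) * w / (1 - w)))

lemma analyticAt_generating (p : ℝ) (b : ℂ) (k : ℕ) : AnalyticAt ℂ (generating p b k) 0 := by
  have h1 : AnalyticAt ℂ (fun w : ℂ => 1 - w) 0 := analyticAt_const.sub analyticAt_id
  refine (h1.cpow analyticAt_const (by simp)).mul ?_
  exact (((analyticAt_const.mul analyticAt_id).div h1 (by simp)).neg).cexp

lemma generating_taylor (p : ℝ) (b : ℂ) (k n : ℕ) :
    (fun t => generating p b k t
      - ∑ l ∈ Finset.range n, (-1) ^ l / (l.factorial : ℂ) * taylorCoeff p b l k * t ^ l)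
      =O[𝓝 0] fun t => t ^ n := by
  have h := (analyticAt_generating p b k).hasFPowerSeriesAt.isBigO_sub_partialSum_pow n
  rw [← isBigO_norm_right]
  simp only [zero_add] at h
  simp only [norm_pow]
  refine h.congr_left fun t => ?_
  rw [FormalMultilinearSeries.partialSum]
  congr 1
  refine Finset.sum_congr rfl fun l _ => ?_
  rw [FormalMultilinearSeries.ofScalars_apply_eq, taylorCoeff, smul_eq_mul]
  -- The sign built into `taylorCoeff` cancels the one in the sum.
  have : ((-1 : ℂ) ^ l) * (-1) ^ l = 1 := by rw [← mul_pow]; simp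
  rw [show (-1 : ℂ) ^ l / l.factorial * ((-1) ^ l * iteratedDeriv l
      (fun w : ℂ => (1 - w) ^ (b + (k : ℂ)) * Complex.exp (-((p : ℂ) * w / (1 - w)))) 0)
    = ((-1 : ℂ) ^ l * (-1) ^ l) * (iteratedDeriv l (fun w : ℂ => (1 - w) ^ (b + (k : ℂ)) *
      Complex.exp (-((p : ℂ) * w / (1 - w)))) 0 / l.factorial) by ring, this, one_mul]
  rfl

/-- The polynomial `e^{-p} ∑_{r<N} D_r (t/p)^r`. -/
noncomputable def expansionPoly (p ν : ℝ) (b : ℂ) (N : ℕ) (t : ℂ) : ℂ :=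
  ∑ r ∈ Finset.range N, Complex.exp (-(p : ℂ)) * D p ν b r * (t / p) ^ r

/-- The definition of D_r collects the terms with k + l = r in the product of the Hankel and Taylor
expansions. -/
lemma expansionPoly_eq {p : ℝ} (hp : 0 < p) (ν : ℝ) (b : ℂ) (N : ℕ) (t : ℂ) :
    expansionPoly p ν b N t = ∑ k ∈ Finset.range N, Complex.exp (-(p : ℂ)) * besselCoeff ν k *
      (t / p) ^ k * ∑ l ∈ Finset.range (N - k),
        (-1) ^ l / (l.factorial : ℂ) * taylorCoeff p b l k * t ^ l := by
  have hp' : (p : ℂ) ≠ 0 := by exact_mod_cast hp.ne'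
  simp only [Finset.mul_sum]
  rw [← Finset.sum_range_diag_flip N (fun k l => Complex.exp (-(p : ℂ)) * besselCoeff ν k *
      (t / p) ^ k * ((-1) ^ l / (l.factorial : ℂ) * taylorCoeff p b l k * t ^ l)), expansionPoly]
  refine Finset.sum_congr rfl fun r _ => ?_
  rw [D, ← Finset.sum_range_reflect]
  simp only [Finset.mul_sum, Finset.sum_mul]
  refine Finset.sum_congr rfl fun k hk => ?_
  have hk' : k ≤ r := Nat.lt_succ_iff.1 (Finset.mem_range.1 hk)
  obtain ⟨l, rfl⟩ := Nat.exists_eq_add_of_le hk'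
  rw [show k + l + 1 - 1 - k = l by omega, show k + l - l = k by omega,
    show k + l - k = l by omega]
  rw [div_pow, div_pow, pow_add, pow_add]
  field_simp

/-- Both arguments are below π/2 in modulus, so their sum stays on the principal branch. -/
lemma mul_cpow_of_re_pos {z w : ℂ} (hz : 0 < z.re) (hw : 0 < w.re) (c : ℂ) :
    (z * w) ^ c = z ^ c * w ^ c := by
  have hz0 : z ≠ 0 := by rintro rfl; simp at hz
  have hw0 : w ≠ 0 := by rintro rfl; simp at hw
  have h1 := abs_lt.1 (Complex.abs_arg_lt_pi_div_two_iff.2 (Or.inl hz))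
  have h2 := abs_lt.1 (Complex.abs_arg_lt_pi_div_two_iff.2 (Or.inl hw))
  rw [Complex.cpow_def_of_ne_zero (mul_ne_zero hz0 hw0), Complex.cpow_def_of_ne_zero hz0,
    Complex.cpow_def_of_ne_zero hw0, Complex.log_mul hz0 hw0 ⟨by linarith, by linarith⟩,
    add_mul, Complex.exp_add]

lemma ofReal_mul_cpow {r : ℝ} (hr : 0 < r) {z : ℂ} (hz : z ≠ 0) (c : ℂ) :
    ((r : ℂ) * z) ^ c = (r : ℂ) ^ c * z ^ c := by
  have hr0 : (r : ℂ) ≠ 0 := by exact_mod_cast hr.ne'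
  rw [Complex.cpow_def_of_ne_zero (mul_ne_zero hr0 hz), Complex.cpow_def_of_ne_zero hz,
    Complex.cpow_def_of_ne_zero hr0, Complex.log_ofReal_mul hr hz, Complex.ofReal_log hr.le,
    add_mul, Complex.exp_add]

/-- `amplitude` with its essential singularity and its square root at `0` removed. -/
noncomputable def reducedAmplitude (p ν : ℝ) (b t : ℂ) : ℂ :=
  amplitude p ν b t * Complex.exp (p / t) / t ^ (1 / 2 : ℂ)

/-- The remainder in the expansion of `e^Z K_ν(Z)` after `N` terms. -/
noncomputable def besselRemainder (ν : ℝ) (N : ℕ) (Z : ℂ) : ℂ :=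
  Complex.exp Z * besselK ν Z - (Real.pi / (2 * Z)) ^ (1 / 2 : ℂ) *
    ∑ k ∈ Finset.range N, besselCoeff ν k * (1 / Z) ^ k

lemma sqrt_const_mul {p : ℝ} (hp : 0 < p) :
    (Real.sqrt (2 * p / Real.pi) : ℂ) * ((Real.pi / (2 * p) : ℝ) : ℂ) ^ (1 / 2 : ℂ) = 1 := by
  have h : (1 / 2 : ℂ) = ((1 / 2 : ℝ) : ℂ) := by push_cast; rfl
  have hpi := Real.pi_pos
  rw [h, ← Complex.ofReal_cpow (by positivity), ← Real.sqrt_eq_rpow, ← Complex.ofReal_mul,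
    ← Real.sqrt_mul (by positivity)]
  rw [show 2 * p / Real.pi * (Real.pi / (2 * p)) = 1 by field_simp]
  simp

/-- With Z = p/(t(1-t)): 1/Z = (t/p)(1-t) yields the powers, (π/2Z)^{1/2} cancels the constant and
t^{1/2} and raises b - 1/2 to b, and e^{p/t} = e^{-p/(1-t)} e^Z with e^{-p/(1-t)} = e^{-p}
e^{-pt/(1-t)}. -/
lemma reducedAmplitude_eq {p : ℝ} (hp : 0 < p) (ν : ℝ) (b : ℂ) (N : ℕ) {t : ℂ}
    (ht : t ∈ quarterSector) (h : ‖t‖ ≤ 1 / 2) :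
    reducedAmplitude p ν b t =
      ∑ k ∈ Finset.range N, Complex.exp (-(p : ℂ)) * besselCoeff ν k * (t / p) ^ k *
        generating p b k t +
      (Real.sqrt (2 * p / Real.pi) : ℂ) * (1 - t) ^ (b - 1 / 2) * Complex.exp (-(p / (1 - t)))
        * besselRemainder ν N (p / (t * (1 - t))) / t ^ (1 / 2 : ℂ) := by
  have hp' : (p : ℂ) ≠ 0 := by exact_mod_cast hp.ne'
  have h1 := one_sub_ne_zero_of_norm h
  have hr := re_one_sub_pos h
  have ht0 := ht.2
  have htr := re_pos_of_mem ht
  set Z : ℂ := p / (t * (1 - t)) with hZ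
  have hZi : 1 / Z = t / p * (1 - t) := by rw [hZ]; field_simp
  have hroot : (Real.pi / (2 * Z)) ^ (1 / 2 : ℂ)
      = ((Real.pi / (2 * p) : ℝ) : ℂ) ^ (1 / 2 : ℂ) * (t ^ (1 / 2 : ℂ) * (1 - t) ^ (1 / 2 : ℂ)) := by
    rw [← mul_cpow_of_re_pos htr hr, ← ofReal_mul_cpow (by have := Real.pi_pos; positivity)
      (mul_ne_zero ht0 h1), hZ]
    congr 1
    push_cast
    field_simp
  have hexp : Complex.exp (p / t) = Complex.exp (-(p / (1 - t))) * Complex.exp Z := by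
    rw [← Complex.exp_add, hZ, argument_eq p ht0 h1]
    congr 1
    ring
  have hK : Complex.exp Z * besselK ν Z = (Real.pi / (2 * Z)) ^ (1 / 2 : ℂ) *
      ∑ k ∈ Finset.range N, besselCoeff ν k * (1 / Z) ^ k + besselRemainder ν N Z := by
    rw [besselRemainder]; ring
  have hth : t ^ (1 / 2 : ℂ) ≠ 0 := by simp [Complex.cpow_eq_zero_iff, ht0]
  have hb : (1 - t) ^ (b - 1 / 2) * (1 - t) ^ (1 / 2 : ℂ) = (1 - t) ^ b := by
    rw [← Complex.cpow_add _ _ h1, sub_add_cancel]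
  have hgen : ∀ k, Complex.exp (-(p : ℂ)) * generating p b k t
      = (1 - t) ^ b * Complex.exp (-(p / (1 - t))) * (1 - t) ^ k := fun k => by
    rw [generating, Complex.cpow_add _ _ h1, Complex.cpow_natCast]
    have : Complex.exp (-(p / (1 - t))) =
        Complex.exp (-(p : ℂ)) * Complex.exp (-((p : ℂ) * t / (1 - t))) := by
      rw [← Complex.exp_add]
      congr 1
      field_simp
      ring
    rw [this]; ring
  have hsum : ∑ k ∈ Finset.range N, Complex.exp (-(p : ℂ)) * besselCoeff ν k * (t / p) ^ k *
        generating p b k t = (1 - t) ^ b * Complex.exp (-(p / (1 - t))) *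
          ∑ k ∈ Finset.range N, besselCoeff ν k * (1 / Z) ^ k := by
    rw [Finset.mul_sum]
    refine Finset.sum_congr rfl fun k _ => ?_
    rw [hZi, mul_pow]
    linear_combination besselCoeff ν k * (t / p) ^ k * hgen k
  rw [hsum, reducedAmplitude, amplitude, ← hZ, hexp, ← hb]
  rw [div_eq_iff hth, add_mul, div_mul_cancel₀ _ hth]
  have hc := sqrt_const_mul hp
  rw [hroot] at hK
  linear_combination (Real.sqrt (2 * p / Real.pi) : ℂ) * (1 - t) ^ (b - 1 / 2) *
    Complex.exp (-(p / (1 - t))) * hK + (1 - t) ^ (b - 1 / 2) *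
    Complex.exp (-(p / (1 - t))) * (t ^ (1 / 2 : ℂ) * (1 - t) ^ (1 / 2 : ℂ)) *
    (∑ k ∈ Finset.range N, besselCoeff ν k * (1 / Z) ^ k) * hc

lemma norm_besselRemainder_le (ν : ℝ) (N : ℕ) :
    ∃ C : ℝ, 0 ≤ C ∧ ∀ Z : ℂ, 1 ≤ Z.re →
      ‖besselRemainder ν N Z‖ ≤ C * (1 / Z.re) ^ N * √(1 / Z.re) := by
  obtain ⟨C, hC, h⟩ := besselK_expansion ν N
  refine ⟨C, hC, fun Z hZ => ?_⟩
  have := h Z hZ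
  simp only [hankelCoeff_ofReal] at this
  rwa [Real.sqrt_div' 1 (by linarith), Real.sqrt_one]

lemma reducedAmplitude_expansion {p : ℝ} (hp : 0 < p) (ν : ℝ) (b : ℂ) (N : ℕ) :
    (fun t => reducedAmplitude p ν b t - expansionPoly p ν b N t)
      =O[𝓝[quarterSector] 0] fun t => t ^ N := by
  have hp' : (p : ℂ) ≠ 0 := by exact_mod_cast hp.ne'
  have hsmall : ∀ r : ℝ, 0 < r → ∀ᶠ t in 𝓝[quarterSector] (0 : ℂ), ‖t‖ ≤ r := fun r hr =>
    eventually_nhdsWithin_of_eventually_nhds (by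
      filter_upwards [Metric.closedBall_mem_nhds (0 : ℂ) hr] with t ht using by simpa using ht)
  have hmem : ∀ᶠ t in 𝓝[quarterSector] (0 : ℂ), t ∈ quarterSector := self_mem_nhdsWithin
  have hmain : (fun t => ∑ k ∈ Finset.range N, (Complex.exp (-(p : ℂ)) * besselCoeff ν k *
      (t / p) ^ k * (generating p b k t - ∑ l ∈ Finset.range (N - k),
        (-1) ^ l / (l.factorial : ℂ) * taylorCoeff p b l k * t ^ l)))
      =O[𝓝[quarterSector] 0] fun t => t ^ N := by
    refine IsBigO.fun_sum fun k hk => ?_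
    have hk' : k ≤ N := (Finset.mem_range.1 hk).le
    have h1 : (fun t : ℂ => Complex.exp (-(p : ℂ)) * besselCoeff ν k * (t / p) ^ k)
        =O[𝓝[quarterSector] 0] fun t => t ^ k := by
      have : (fun t : ℂ => Complex.exp (-(p : ℂ)) * besselCoeff ν k * (t / p) ^ k)
        = fun t => (Complex.exp (-(p : ℂ)) * besselCoeff ν k / p ^ k) * t ^ k := by
        ext t; rw [div_pow]; ring
      rw [this]
      exact isBigO_const_mul_self _ _ _
    have h2 := h1.mul ((generating_taylor p b k (N - k)).mono nhdsWithin_le_nhds)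
    refine h2.congr_right fun t => ?_
    rw [← pow_add, Nat.add_sub_cancel' hk']
  have herr : (fun t : ℂ => (Real.sqrt (2 * p / Real.pi) : ℂ) * (1 - t) ^ (b - 1 / 2) *
      Complex.exp (-(p / (1 - t))) * (besselRemainder ν N (p / (t * (1 - t))) / t ^ (1 / 2 : ℂ)))
      =O[𝓝[quarterSector] 0] fun t => t ^ N := by
    have h1 : (fun t : ℂ => (Real.sqrt (2 * p / Real.pi) : ℂ) * (1 - t) ^ (b - 1 / 2) *
      Complex.exp (-(p / (1 - t)))) =O[𝓝[quarterSector] 0] fun _ => (1 : ℂ) := by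
      have hc : ContinuousAt (fun t : ℂ => (Real.sqrt (2 * p / Real.pi) : ℂ) *
          (1 - t) ^ (b - 1 / 2) * Complex.exp (-(p / (1 - t)))) 0 := by
        have h1 : ContinuousAt (fun w : ℂ => 1 - w) 0 := by fun_prop
        refine (continuousAt_const.mul (h1.cpow continuousAt_const (by simp))).mul ?_
        exact ((continuousAt_const.div h1 (by simp)).neg).cexp
      exact (hc.isBigO_one ℂ).mono nhdsWithin_le_nhds
    have h2 : (fun t : ℂ => besselRemainder ν N (p / (t * (1 - t))) / t ^ (1 / 2 : ℂ))
        =O[𝓝[quarterSector] 0] fun t => t ^ N := by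
      obtain ⟨C, hC, hb⟩ := norm_besselRemainder_le ν N
      -- Re Z ≥ p/(2|t|) makes the Bessel remainder O(|t|^{N+1/2}); the half power pays for the
      -- division by t^{1/2}.
      refine IsBigO.of_bound (C * (2 / p) ^ N * √(2 / p)) ?_
      filter_upwards [hmem, hsmall (1 / 2) (by norm_num), hsmall (p / 2) (by positivity)]
        with t ht hs1 hs2
      have hn : 0 < ‖t‖ := norm_pos_iff.2 ht.2
      have hre := re_argument_ge hp ht hs1
      have hone : 1 ≤ p * (1 / (2 * ‖t‖)) := by
        rw [mul_one_div, le_div_iff₀ (by positivity)]; linarith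
      set Z : ℂ := p / (t * (1 - t))
      have hinv : 1 / Z.re ≤ 2 / p * ‖t‖ := by
        rw [div_le_iff₀ (by linarith)]
        calc (1 : ℝ) = 2 / p * ‖t‖ * (p * (1 / (2 * ‖t‖))) := by field_simp
          _ ≤ _ := by gcongr
      have hZ0 : 0 ≤ 1 / Z.re := by
        have : 0 < Z.re := by linarith
        positivity
      rw [norm_div, norm_cpow_half, norm_pow, div_le_iff₀ (Real.sqrt_pos.2 hn)]
      calc _ ≤ C * (1 / Z.re) ^ N * √(1 / Z.re) := hb Z (hone.trans hre)
        _ ≤ C * (2 / p * ‖t‖) ^ N * √(2 / p * ‖t‖) := by gcongr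
        _ = _ := by
          rw [mul_pow, Real.sqrt_mul (by positivity)]; ring
    simpa using h1.mul h2
  refine (hmain.add herr).congr' ?_ EventuallyEq.rfl
  filter_upwards [hmem, hsmall (1 / 2) (by norm_num)] with t ht hs
  rw [reducedAmplitude_eq hp ν b N ht hs, expansionPoly_eq hp]
  simp only [mul_sub, Finset.sum_sub_distrib]
  ring

/-- A radius below which the expansion of `reducedAmplitude` holds with a uniform constant. -/
lemma exists_radius {p : ℝ} (hp : 0 < p) (ν : ℝ) (b : ℂ) (N : ℕ) :
    ∃ c C : ℝ, 0 < c ∧ c ≤ 1 / 2 ∧ 0 ≤ C ∧ ∀ t ∈ quarterSector, ‖t‖ ≤ c →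
      ‖reducedAmplitude p ν b t - expansionPoly p ν b N t‖ ≤ C * ‖t‖ ^ N ∧
      ‖reducedAmplitude p ν b t‖ ≤ C := by
  obtain ⟨C₁, hC₁, h₁⟩ := (reducedAmplitude_expansion hp ν b N).exists_nonneg
  -- Order zero is boundedness of the amplitude.
  obtain ⟨C₂, hC₂, h₂⟩ := (reducedAmplitude_expansion hp ν b 0).exists_nonneg
  have h := h₁.bound.and h₂.bound
  rw [eventually_nhdsWithin_iff, Metric.eventually_nhds_iff] at h
  obtain ⟨ε, hε, h⟩ := h
  refine ⟨min (ε / 2) (1 / 2), max C₁ C₂, by positivity, min_le_right _ _,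
    hC₁.trans (le_max_left _ _), fun t ht hn => ?_⟩
  have hd : dist t 0 < ε := by
    rw [dist_zero_right]
    linarith [hn.trans (min_le_left _ _)]
  obtain ⟨k1, k2⟩ := h hd ht
  rw [norm_pow] at k1
  constructor
  · exact k1.trans (by gcongr; exact le_max_left _ _)
  · simp only [expansionPoly, Finset.range_zero, Finset.sum_empty, sub_zero, pow_zero, norm_one,
      mul_one] at k2
    exact k2.trans (le_max_right _ _)

/-! ### Absolute convergence, reflection and the first coefficient. -/

lemma rpow_mul_exp_neg_div_le (α : ℝ) {q : ℝ} (hq : 0 < q) :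
    ∃ C : ℝ, ∀ t : ℝ, 0 < t → t ≤ 1 → t ^ α * Real.exp (-(q / t)) ≤ C := by
  obtain ⟨n, hn⟩ := exists_nat_ge (-α)
  refine ⟨n.factorial * (1 / q) ^ n, fun t ht ht1 => ?_⟩
  have h1 : t ^ α ≤ (1 / t) ^ n := by
    rw [one_div, inv_pow, ← Real.rpow_natCast, ← Real.rpow_neg ht.le]
    exact Real.rpow_le_rpow_of_exponent_ge ht ht1 (by linarith)
  have h2 := Real.pow_div_factorial_le_exp (q / t) (by positivity) n
  rw [div_le_iff₀ (by positivity)] at h2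
  have h3 : (1 / t) ^ n = (1 / q) ^ n * (q / t) ^ n := by
    rw [← mul_pow]; congr 1; field_simp
  calc _ ≤ (1 / t) ^ n * Real.exp (-(q / t)) := by gcongr
    _ ≤ (1 / q) ^ n * (Real.exp (q / t) * n.factorial) * Real.exp (-(q / t)) := by
        rw [h3]; gcongr
    _ = n.factorial * (1 / q) ^ n * (Real.exp (q / t) * Real.exp (-(q / t))) := by ring
    _ = _ := by rw [← Real.exp_add]; simp

lemma continuousOn_integrand {p : ℝ} (hp : 0 < p) (ν : ℝ) (a b z : ℂ) :
    ContinuousOn (integrand p ν a b z) (Set.Ioo 0 1) := by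
  intro t ht
  have ht0 : 0 < t := ht.1
  have ht1 : 0 < 1 - t := by linarith [ht.2]
  have hne : t * (1 - t) ≠ 0 := by positivity
  refine ContinuousAt.continuousWithinAt ?_
  have c1 : ContinuousAt (fun s : ℝ => (s : ℂ) ^ (a - 1 / 2)) t :=
    Complex.continuous_ofReal.continuousAt.cpow continuousAt_const (by simp [ht0])
  have c2 : ContinuousAt (fun s : ℝ => (1 - (s : ℂ)) ^ (b - 1 / 2)) t :=
    (continuousAt_const.sub Complex.continuous_ofReal.continuousAt).cpow continuousAt_const
      (Or.inl (by simpa using ht.2))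
  have c3 : ContinuousAt (fun s : ℝ => Complex.exp (z * s)) t := by fun_prop
  have c4 : ContinuousAt (fun s : ℝ => ((p / (s * (1 - s)) : ℝ) : ℂ)) t :=
    Complex.continuous_ofReal.continuousAt.comp
      (continuousAt_const.div (by fun_prop) hne)
  have c5 : ContinuousAt (besselK ν) ((p / (t * (1 - t)) : ℝ) : ℂ) :=
    (differentiableAt_besselK (by simp only [Complex.ofReal_re]; positivity) ν).continuousAt
  have c6 : ContinuousAt (fun s : ℝ => besselK ν ((p / (s * (1 - s)) : ℝ) : ℂ)) t :=
    ContinuousAt.comp (f := fun s : ℝ => ((p / (s * (1 - s)) : ℝ) : ℂ)) c5 c4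
  exact ((c1.mul c2).mul c3).mul c6

lemma intervalIntegrable_integrand {p : ℝ} (hp : 0 < p) (ν : ℝ) (a b z : ℂ) :
    IntervalIntegrable (integrand p ν a b z) volume 0 1 := by
  rw [intervalIntegrable_iff_integrableOn_Ioo_of_le zero_le_one]
  obtain ⟨C, hC, hK⟩ := norm_besselK_le (X₀ := p) hp ν
  obtain ⟨A, hA⟩ := rpow_mul_exp_neg_div_le (a.re - 1 / 2) (half_pos hp)
  obtain ⟨B, hB⟩ := rpow_mul_exp_neg_div_le (b.re - 1 / 2) (half_pos hp)
  refine Integrable.of_bound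
    ((continuousOn_integrand hp ν a b z).aestronglyMeasurable measurableSet_Ioo)
    (A * B * Real.exp ‖z‖ * C) ?_
  filter_upwards [ae_restrict_mem measurableSet_Ioo] with t ht
  have ht0 : 0 < t := ht.1
  have ht1 : 0 < 1 - t := by linarith [ht.2]
  have hle : p ≤ p / (t * (1 - t)) := by
    rw [le_div_iff₀ (by positivity)]
    have : t * (1 - t) ≤ 1 := by nlinarith
    nlinarith
  have h1 : ‖(t : ℂ) ^ (a - 1 / 2)‖ = t ^ (a.re - 1 / 2) := by
    rw [Complex.norm_cpow_eq_rpow_re_of_pos ht0]; simp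
  have h2 : ‖(1 - (t : ℂ)) ^ (b - 1 / 2)‖ = (1 - t) ^ (b.re - 1 / 2) := by
    rw [← Complex.ofReal_one, ← Complex.ofReal_sub, Complex.norm_cpow_eq_rpow_re_of_pos ht1]; simp
  have h3 : ‖Complex.exp (z * t)‖ ≤ Real.exp ‖z‖ := by
    refine (norm_cexp_mul_le z t).trans (Real.exp_le_exp.2 ?_)
    rw [abs_of_pos ht0]
    exact mul_le_of_le_one_right (norm_nonneg _) ht.2.le
  have h4 := hK ((p / (t * (1 - t)) : ℝ) : ℂ) (by rwa [Complex.ofReal_re])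
  rw [Complex.ofReal_re] at h4
  -- The decay factors over the two endpoints, and each factor beats the endpoint power whatever a
  -- and b are.
  have h5 : Real.exp (-(p / (t * (1 - t)) / 2))
      = Real.exp (-(p / 2 / t)) * Real.exp (-(p / 2 / (1 - t))) := by
    rw [← Real.exp_add]; congr 1; field_simp; ring
  rw [integrand, norm_mul, norm_mul, norm_mul, h1, h2]
  calc _ ≤ t ^ (a.re - 1 / 2) * (1 - t) ^ (b.re - 1 / 2) * Real.exp ‖z‖ *
        (C * Real.exp (-(p / (t * (1 - t)) / 2))) := by gcongr
    _ = (t ^ (a.re - 1 / 2) * Real.exp (-(p / 2 / t))) *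
        ((1 - t) ^ (b.re - 1 / 2) * Real.exp (-(p / 2 / (1 - t)))) * Real.exp ‖z‖ * C := by
        rw [h5]; ring
    _ ≤ _ := by
        have hA' := hA t ht0 ht.2.le
        have hB' := hB (1 - t) ht1 (by linarith)
        have : 0 ≤ A := le_trans (by positivity) hA'
        gcongr

lemma I_symm (p ν : ℝ) (a b z : ℂ) : I p ν a b z = Complex.exp z * I p ν b a (-z) := by
  have h : ∀ t : ℝ, integrand p ν a b z (1 - t)
      = Complex.exp z * integrand p ν b a (-z) t := fun t => by
    have e : Complex.exp (z * (1 - t)) = Complex.exp z * Complex.exp (-z * t) := by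
      rw [← Complex.exp_add]; congr 1; ring
    rw [integrand, integrand, Complex.ofReal_sub, Complex.ofReal_one, e, sub_sub_cancel,
      sub_sub_cancel, mul_comm (1 - t) t]
    ring
  have h2 := intervalIntegral.integral_comp_sub_left (a := 0) (b := 1)
    (integrand p ν a b z) 1
  rw [sub_self, sub_zero] at h2
  rw [I, I, ← h2]
  simp only [h]
  rw [intervalIntegral.integral_const_mul]
  ring

lemma D_zero (p ν : ℝ) (b : ℂ) : D p ν b 0 = 1 := by
  simp [D, besselCoeff, taylorCoeff]

/-! ### The logarithmic variable and the rotation of the contour. -/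

/-- The integrand of `I(a,b;-x)` in the variable `w = log t`. -/
noncomputable def logIntegrand (p ν : ℝ) (a b x w : ℂ) : ℂ :=
  Complex.exp ((a + 1 / 2) * w) * Complex.exp (-x * Complex.exp w)
    * amplitude p ν b (Complex.exp w)

lemma integral_Ioc_eq_logIntegrand (p ν : ℝ) (a b x : ℂ) {c : ℝ} (hc : 0 < c) :
    (Real.sqrt (2 * p / Real.pi) : ℂ) * ∫ t in (0 : ℝ)..c, integrand p ν a b (-x) t
      = ∫ u in Set.Iic (Real.log c), logIntegrand p ν a b x u := by
  have himg : Real.exp '' Set.Iic (Real.log c) = Set.Ioc 0 c := by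
    ext y
    constructor
    · rintro ⟨u, hu, rfl⟩
      exact ⟨Real.exp_pos u, (Real.le_log_iff_exp_le hc).1 hu⟩
    · intro hy
      exact ⟨Real.log y, Real.log_le_log hy.1 hy.2, Real.exp_log hy.1⟩
  have h := integral_image_eq_integral_abs_deriv_smul measurableSet_Iic
    (fun u (_ : u ∈ Set.Iic (Real.log c)) => (Real.hasDerivAt_exp u).hasDerivWithinAt)
    Real.exp_injective.injOn (integrand p ν a b (-x))
  rw [intervalIntegral.integral_of_le hc.le, ← himg, h, ← integral_const_mul]
  refine integral_congr_ae (Eventually.of_forall fun u => ?_)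
  have hcp : (Complex.exp u : ℂ) ^ (a - 1 / 2) = Complex.exp ((a - 1 / 2) * u) := by
    rw [Complex.cpow_def_of_ne_zero (Complex.exp_ne_zero _), ← Complex.ofReal_exp,
      ← Complex.ofReal_log (Real.exp_pos u).le, Real.log_exp, mul_comm]
  have he : Complex.exp ((a + 1 / 2) * u) = Complex.exp u * Complex.exp ((a - 1 / 2) * u) := by
    rw [← Complex.exp_add]; congr 1; ring
  simp only [integrand, logIntegrand, amplitude, Complex.real_smul, abs_of_pos (Real.exp_pos u)]
  push_cast
  rw [hcp, he]
  ring

lemma I_neg_eq {p : ℝ} (hp : 0 < p) (ν : ℝ) (a b x : ℂ) {c : ℝ} (hc : 0 < c) (hc1 : c ≤ 1) :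
    I p ν a b (-x) = (∫ u in Set.Iic (Real.log c), logIntegrand p ν a b x u) +
      (Real.sqrt (2 * p / Real.pi) : ℂ) * ∫ t in c..1, integrand p ν a b (-x) t := by
  have h := intervalIntegrable_integrand hp ν a b (-x)
  have hmem : c ∈ Set.uIcc (0 : ℝ) 1 := by rw [Set.uIcc_of_le zero_le_one]; exact ⟨hc.le, hc1⟩
  rw [← integral_Ioc_eq_logIntegrand p ν a b x hc, I, ← mul_add,
    intervalIntegral.integral_add_adjacent_intervals
      (h.mono_set (Set.uIcc_subset_uIcc_left hmem)) (h.mono_set (Set.uIcc_subset_uIcc_right hmem))]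

lemma norm_integral_tail_le {p : ℝ} (hp : 0 < p) (ν : ℝ) (a b : ℂ) {c : ℝ} (hc : 0 < c)
    (hc1 : c ≤ 1) : ∃ C : ℝ, 0 ≤ C ∧ ∀ x : ℂ, 0 ≤ x.re →
      ‖(Real.sqrt (2 * p / Real.pi) : ℂ) * ∫ t in c..1, integrand p ν a b (-x) t‖
        ≤ C * Real.exp (-(c * x.re)) := by
  have hmem : c ∈ Set.uIcc (0 : ℝ) 1 := by rw [Set.uIcc_of_le zero_le_one]; exact ⟨hc.le, hc1⟩
  have hint := ((intervalIntegrable_integrand hp ν a b 0).mono_set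
    (Set.uIcc_subset_uIcc_right hmem)).norm
  refine ⟨‖(Real.sqrt (2 * p / Real.pi) : ℂ)‖ * ∫ t in c..1, ‖integrand p ν a b 0 t‖,
    mul_nonneg (norm_nonneg _) (intervalIntegral.integral_nonneg hc1 fun _ _ => norm_nonneg _),
    fun x hx => ?_⟩
  rw [norm_mul, mul_assoc, ← intervalIntegral.integral_mul_const]
  gcongr
  refine intervalIntegral.norm_integral_le_of_norm_le hc1 (Eventually.of_forall fun t ht => ?_)
    (hint.mul_const _)
  have h1 : integrand p ν a b (-x) t = integrand p ν a b 0 t * Complex.exp (-x * t) := by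
    rw [integrand, integrand, zero_mul, Complex.exp_zero]; ring
  rw [h1, norm_mul, Complex.norm_exp, Complex.re_mul_ofReal, Complex.neg_re]
  gcongr
  nlinarith [ht.1]

lemma integrableOn_line {F : ℝ → ℂ} {m C : ℝ} (hF : ContinuousOn F (Set.Iic m))
    (hb : ∀ u ≤ m, ‖F u‖ ≤ C * Real.exp u) : IntegrableOn F (Set.Iic m) := by
  refine ((integrableOn_exp_Iic m).const_mul C).mono'
    (hF.aestronglyMeasurable measurableSet_Iic) ?_
  filter_upwards [ae_restrict_mem measurableSet_Iic] with u hu using hb u hu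

/-- Moving a horizontal half-line of integration vertically. -/
lemma integral_Iic_shift {Φ : ℂ → ℂ} {m y C : ℝ}
    (hΦ : ∀ w : ℂ, w.re ≤ m → w.im ∈ Set.uIcc 0 y → DifferentiableAt ℂ Φ w)
    (hb : ∀ w : ℂ, w.re ≤ m → w.im ∈ Set.uIcc 0 y → ‖Φ w‖ ≤ C * Real.exp w.re) :
    ∫ u in Set.Iic m, Φ u = (∫ u in Set.Iic m, Φ (u + y * Complex.I))
      - Complex.I * ∫ v in (0 : ℝ)..y, Φ (m + v * Complex.I) := by
  have hline : ∀ v ∈ Set.uIcc 0 y, IntegrableOn (fun u : ℝ => Φ (u + v * Complex.I))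
      (Set.Iic m) := fun v hv => by
    refine integrableOn_line (C := C) (fun u hu => ?_) fun u hu => ?_
    · have h1 := (hΦ (u + v * Complex.I) (by simpa using hu) (by simpa using hv)).continuousAt
      exact (ContinuousAt.comp (f := fun u : ℝ => (u : ℂ) + v * Complex.I) h1
        (by fun_prop)).continuousWithinAt
    · have := hb (u + v * Complex.I) (by simpa using hu) (by simpa using hv)
      simpa using this
  have h0 := hline 0 Set.left_mem_uIcc
  have hy := hline y Set.right_mem_uIcc
  have l0 := intervalIntegral_tendsto_integral_Iic m h0 tendsto_id
  have ly := intervalIntegral_tendsto_integral_Iic m hy tendsto_id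
  -- The far side of the Cauchy rectangle vanishes in the limit.
  have lleft : Tendsto (fun M : ℝ => Complex.I * ∫ v in (0 : ℝ)..y, Φ (M + v * Complex.I)) atBot
      (𝓝 0) := by
    have hz : Tendsto (fun M : ℝ => C * Real.exp M * |y - 0|) atBot (𝓝 0) := by
      simpa using (Real.tendsto_exp_atBot.const_mul C).mul_const |y - 0|
    refine squeeze_zero_norm' ?_ hz
    filter_upwards [eventually_le_atBot m] with M hM
    rw [norm_mul, Complex.norm_I, one_mul]
    refine intervalIntegral.norm_integral_le_of_norm_le_const fun v hv => ?_
    have := hb (M + v * Complex.I) (by simpa using hM)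
      (by simpa using Set.uIoc_subset_uIcc hv)
    simpa using this
  have hrect : ∀ᶠ M : ℝ in atBot, (∫ u in M..m, Φ (u + (0 : ℝ) * Complex.I))
      - (∫ u in M..m, Φ (u + y * Complex.I))
      + Complex.I * (∫ v in (0 : ℝ)..y, Φ (m + v * Complex.I))
      - Complex.I * (∫ v in (0 : ℝ)..y, Φ (M + v * Complex.I)) = 0 := by
    filter_upwards [eventually_le_atBot m] with M hM
    have h := Complex.integral_boundary_rect_eq_zero_of_differentiableOn Φ (M : ℂ)
      (m + y * Complex.I) (fun w hw => by
        simp only [Complex.ofReal_re, Complex.add_re, Complex.mul_re, Complex.I_re, mul_zero,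
          Complex.ofReal_im, Complex.I_im, mul_one, sub_self, add_zero, Complex.add_im,
          Complex.mul_im, zero_add, Complex.mem_reProdIm, Set.uIcc_of_le hM] at hw
        exact (hΦ w hw.1.2 hw.2).differentiableWithinAt)
    simpa using h
  have hlim := ((l0.sub ly).add_const
    (Complex.I * (∫ v in (0 : ℝ)..y, Φ (m + v * Complex.I)))).sub lleft
  have := tendsto_nhds_unique (hlim.congr' hrect) tendsto_const_nhds
  simp only [Complex.ofReal_zero, zero_mul, add_zero, sub_zero] at this
  linear_combination this

lemma abs_sin_le_cos {y : ℝ} (hy : |y| ≤ Real.pi / 4) : |Real.sin y| ≤ Real.cos y := by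
  obtain ⟨h1, h2⟩ := abs_le.1 hy
  have hpi := Real.pi_pos
  have hc : 0 ≤ Real.cos y := Real.cos_nonneg_of_mem_Icc ⟨by linarith, by linarith⟩
  have h3 : 0 ≤ Real.cos (2 * y) := Real.cos_nonneg_of_mem_Icc ⟨by linarith, by linarith⟩
  rw [Real.cos_two_mul] at h3
  have h4 := Real.sin_sq_add_cos_sq y
  exact abs_le_of_sq_le_sq (by linarith) hc

lemma exp_mem_quarterSector {w : ℂ} (hw : |w.im| ≤ Real.pi / 4) :
    Complex.exp w ∈ quarterSector := by
  refine ⟨?_, Complex.exp_ne_zero w⟩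
  rw [Complex.exp_re, Complex.exp_im, abs_mul, abs_of_pos (Real.exp_pos _)]
  gcongr
  exact abs_sin_le_cos hw

lemma differentiableAt_logIntegrand {p : ℝ} (hp : 0 < p) (ν : ℝ) (a b x : ℂ) {w : ℂ}
    (hw : |w.im| ≤ Real.pi / 4) (hre : Real.exp w.re ≤ 1 / 2) :
    DifferentiableAt ℂ (logIntegrand p ν a b x) w := by
  have ht := exp_mem_quarterSector hw
  have hn : ‖Complex.exp w‖ ≤ 1 / 2 := by rwa [Complex.norm_exp]
  have h1 := one_sub_ne_zero_of_norm hn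
  have hpos : 0 < ((p : ℂ) / (Complex.exp w * (1 - Complex.exp w))).re := by
    refine lt_of_lt_of_le ?_ (re_argument_ge hp ht hn)
    have := norm_pos_iff.2 ht.2
    positivity
  have d1 : DifferentiableAt ℂ (fun w => 1 - Complex.exp w) w := by fun_prop
  have d2 : DifferentiableAt ℂ (fun w => (p : ℂ) / (Complex.exp w * (1 - Complex.exp w))) w :=
    (differentiableAt_const _).div (by fun_prop) (mul_ne_zero ht.2 h1)
  have d3 := DifferentiableAt.comp
    (f := fun w => (p : ℂ) / (Complex.exp w * (1 - Complex.exp w))) w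
    (differentiableAt_besselK hpos ν) d2
  have d4 : DifferentiableAt ℂ (fun w => (1 - Complex.exp w) ^ (b - 1 / 2)) w :=
    d1.cpow (differentiableAt_const _) (Or.inl (re_one_sub_pos hn))
  have d5 : DifferentiableAt ℂ (fun w => Complex.exp ((a + 1 / 2) * w)
      * Complex.exp (-x * Complex.exp w)) w := by fun_prop
  exact d5.mul ((d4.const_mul _).mul d3)

/-- Exhibits the saddle exponent x e^w + p e^{-w}. The bound on Im w makes the principal root of e^w
equal e^{w/2}. -/
lemma logIntegrand_eq (p ν : ℝ) (a b x : ℂ) {w : ℂ} (hw : |w.im| ≤ Real.pi / 4) :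
    logIntegrand p ν a b x w = Complex.exp ((a + 1) * w) *
      Complex.exp (-(x * Complex.exp w + p * Complex.exp (-w))) *
        reducedAmplitude p ν b (Complex.exp w) := by
  have hpi := Real.pi_pos
  obtain ⟨h1, h2⟩ := abs_le.1 hw
  have hroot : Complex.exp w ^ (1 / 2 : ℂ) = Complex.exp (w / 2) := by
    rw [Complex.cpow_def_of_ne_zero (Complex.exp_ne_zero _),
      Complex.log_exp (by linarith) (by linarith)]
    congr 1; ring
  have e1 : Complex.exp ((a + 1) * w) = Complex.exp ((a + 1 / 2) * w) * Complex.exp (w / 2) := by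
    rw [← Complex.exp_add]; congr 1; ring
  have e2 : Complex.exp (-(x * Complex.exp w + p * Complex.exp (-w)))
      = Complex.exp (-x * Complex.exp w) * Complex.exp (-(p / Complex.exp w)) := by
    rw [← Complex.exp_add, Complex.exp_neg w]; congr 1; ring
  have e3 : Complex.exp (-(p / Complex.exp w)) * Complex.exp (p / Complex.exp w) = 1 := by
    rw [← Complex.exp_add]; simp
  rw [logIntegrand, reducedAmplitude, hroot, e1, e2]
  rw [mul_div_assoc', eq_div_iff (Complex.exp_ne_zero _)]
  linear_combination (-Complex.exp ((a + 1 / 2) * w) * Complex.exp (-x * Complex.exp w) *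
    Complex.exp (w / 2) * amplitude p ν b (Complex.exp w)) * e3

/-- As Re w → -∞, the factor exp(-(p/2) e^{-Re w}) absorbs e^{-n Re w} for n ≥ |a|, leaving e^{Re w}
for integrability. -/
lemma norm_logIntegrand_le {p : ℝ} (hp : 0 < p) {ν : ℝ} (a : ℂ) {b : ℂ} {c C : ℝ} (hc : 0 < c)
    (hC : 0 ≤ C) (hred : ∀ t ∈ quarterSector, ‖t‖ ≤ c → ‖reducedAmplitude p ν b t‖ ≤ C) :
    ∃ C' : ℝ, 0 ≤ C' ∧ ∀ x w : ℂ, |w.im| ≤ Real.pi / 4 → w.re ≤ Real.log c →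
      ‖logIntegrand p ν a b x w‖ ≤ C' * Real.exp (-(x * Complex.exp w).re) * Real.exp w.re := by
  set q : ℝ := p / 2 with hq
  have hq0 : 0 < q := by positivity
  set n : ℕ := ⌈‖a‖⌉₊ with hn
  have hna : ‖a‖ ≤ n := Nat.le_ceil _
  refine ⟨C * (Real.exp (‖a‖ * Real.pi) * (Real.exp (2 * ‖a‖ * |Real.log c|) *
    (n.factorial * (1 / q) ^ n * Real.exp (n * |Real.log c|)))), by positivity,
    fun x w hw hre => ?_⟩
  have ht := exp_mem_quarterSector hw
  have hnt : ‖Complex.exp w‖ ≤ c := by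
    rw [Complex.norm_exp]; exact (Real.le_log_iff_exp_le hc).1 hre
  have hred' := hred _ ht hnt
  set u := w.re with hu
  have hinv : q * Real.exp (-u) ≤ (p * Complex.exp (-w)).re := by
    have := re_inv_ge ht
    rw [Complex.norm_exp, one_div (Complex.exp w), ← Complex.exp_neg] at this
    rw [Complex.re_ofReal_mul, hq, Real.exp_neg]
    calc p / 2 * (Real.exp u)⁻¹ = p * (1 / (2 * Real.exp u)) := by field_simp
      _ ≤ _ := by gcongr
  have hl := neg_abs_le (Real.log c)
  have hl2 := le_abs_self (Real.log c)
  set l := |Real.log c| with hlc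
  have hpow : Real.exp (-(n * u)) * Real.exp (-(q * Real.exp (-u))) ≤
      n.factorial * (1 / q) ^ n := by
    have h2 := Real.pow_div_factorial_le_exp (q * Real.exp (-u)) (by positivity) n
    rw [div_le_iff₀ (by positivity), mul_pow, ← Real.exp_nat_mul] at h2
    rw [Real.exp_neg (q * _), mul_inv_le_iff₀ (Real.exp_pos _), show -(n * u) = n * -u by ring]
    calc Real.exp (n * -u) = (1 / q) ^ n * (q ^ n * Real.exp (n * -u)) := by
          rw [← mul_assoc, ← mul_pow, one_div_mul_cancel hq0.ne', one_pow, one_mul]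
      _ ≤ (1 / q) ^ n * (Real.exp (q * Real.exp (-u)) * n.factorial) := by gcongr
      _ = _ := by ring
  have ha : ‖Complex.exp ((a + 1) * w)‖ ≤ Real.exp (‖a‖ * Real.pi) *
      (Real.exp (2 * ‖a‖ * l) * (Real.exp (n * l) * Real.exp (-(n * u)))) * Real.exp u := by
    rw [Complex.norm_exp, ← Real.exp_add, ← Real.exp_add, ← Real.exp_add, ← Real.exp_add,
      Real.exp_le_exp, add_mul, one_mul, Complex.add_re, ← hu]
    have h1 : (a * w).re ≤ ‖a‖ * ‖w‖ := (Complex.re_le_norm _).trans (norm_mul_le _ _)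
    have h2 : ‖w‖ ≤ |u| + Real.pi := (Complex.norm_le_abs_re_add_abs_im w).trans (by
      have := Real.pi_pos; rw [← hu]; linarith)
    have h3 : |u| ≤ l - u + l := by
      rcases abs_cases u with ⟨h, _⟩ | ⟨h, _⟩ <;> rw [h] <;> linarith
    have h4 : 0 ≤ l - u := by linarith
    have h5 : ‖a‖ * (l - u) ≤ n * (l - u) := by gcongr
    have h6 : ‖a‖ * ‖w‖ ≤ ‖a‖ * (l - u + l + Real.pi) := by
      have := norm_nonneg a
      gcongr
      linarith
    have h7 : 0 ≤ ‖a‖ * l := by positivity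
    linarith
  rw [logIntegrand_eq p ν a b x hw, norm_mul, norm_mul, Complex.norm_exp (-(_ + _)),
    Complex.neg_re, Complex.add_re, neg_add, Real.exp_add]
  have hE : Real.exp (-(p * Complex.exp (-w)).re) ≤ Real.exp (-(q * Real.exp (-u))) :=
    Real.exp_le_exp.2 (by linarith)
  calc _ ≤ (Real.exp (‖a‖ * Real.pi) *
      (Real.exp (2 * ‖a‖ * l) * (Real.exp (n * l) * Real.exp (-(n * u)))) * Real.exp u) *
      (Real.exp (-(x * Complex.exp w).re) * Real.exp (-(q * Real.exp (-u)))) * C := by gcongr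
    _ = C * (Real.exp (‖a‖ * Real.pi) * (Real.exp (2 * ‖a‖ * l) *
      ((Real.exp (-(n * u)) * Real.exp (-(q * Real.exp (-u)))) * Real.exp (n * l)))) *
      Real.exp (-(x * Complex.exp w).re) * Real.exp u := by ring
    _ ≤ _ := by gcongr

lemma sin_le_cos_of_abs_le {φ δ : ℝ} (hδ : 0 < δ) (h : |φ| ≤ Real.pi / 2 - δ) :
    Real.sin δ ≤ Real.cos φ := by
  rw [← Real.cos_pi_div_two_sub, ← Real.cos_abs φ]
  have := Real.pi_pos
  exact Real.cos_le_cos_of_nonneg_of_le_pi (abs_nonneg _) (by linarith) h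

lemma abs_half_arg_le {x : ℂ} {δ : ℝ} (hδ : 0 < δ) (h : |Complex.arg x| ≤ Real.pi / 2 - δ) :
    |-(Complex.arg x) / 2| ≤ Real.pi / 4 := by
  rw [abs_div, abs_neg, abs_of_pos (two_pos (α := ℝ))]
  linarith

lemma abs_le_of_mem_uIcc_zero {v y : ℝ} (hv : v ∈ Set.uIcc 0 y) : |v| ≤ |y| := by
  rcases Set.mem_uIcc.1 hv with ⟨h1, h2⟩ | ⟨h1, h2⟩
  · rw [abs_of_nonneg h1, abs_of_nonneg (h1.trans h2)]; exact h2
  · rw [abs_of_nonpos h2, abs_of_nonpos (h1.trans h2)]; linarith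

lemma abs_add_le_of_mem_uIcc {v θ : ℝ} (hv : v ∈ Set.uIcc 0 (-θ / 2)) : |θ + v| ≤ |θ| := by
  rcases Set.mem_uIcc.1 hv with ⟨h1, h2⟩ | ⟨h1, h2⟩
  · rw [abs_of_nonpos (by linarith), abs_of_nonpos (by linarith)]; linarith
  · rw [abs_of_nonneg (by linarith), abs_of_nonneg (by linarith)]; linarith

/-- Along the arc |t| = c the argument of xt runs from arg x to (arg x)/2, so it never leaves the
sector. -/
lemma sin_mul_norm_le_re_mul_exp {x : ℂ} {δ v : ℝ} (hδ : 0 < δ)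
    (h : |Complex.arg x| ≤ Real.pi / 2 - δ) (hv : v ∈ Set.uIcc 0 (-(Complex.arg x) / 2))
    {c : ℝ} (hc : 0 < c) :
    c * Real.sin δ * ‖x‖ ≤ (x * Complex.exp (Real.log c + v * Complex.I)).re := by
  have h1 : x * Complex.exp (Real.log c + v * Complex.I)
      = ((‖x‖ * c : ℝ) : ℂ) * Complex.exp (((Complex.arg x + v : ℝ) : ℂ) * Complex.I) := by
    nth_rewrite 1 [← Complex.norm_mul_exp_arg_mul_I x]
    rw [Complex.exp_add, ← Complex.ofReal_exp, Real.exp_log hc]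
    push_cast
    rw [add_mul, Complex.exp_add]
    ring
  rw [h1, Complex.re_ofReal_mul, Complex.exp_ofReal_mul_I_re]
  have := sin_le_cos_of_abs_le hδ ((abs_add_le_of_mem_uIcc hv).trans h)
  calc _ = ‖x‖ * c * Real.sin δ := by ring
    _ ≤ _ := by gcongr

section contour

variable {p ν : ℝ} {a b : ℂ} {c C δ : ℝ}

/-- Up to an exponentially small error, `I(a,b;-x)` is an integral along a ray through the saddle
point of `e^{-xt-p/t}`. -/
lemma norm_I_sub_integral_ray_le (hp : 0 < p) (ν : ℝ) (a b : ℂ) (hc : 0 < c) (hc2 : c ≤ 1 / 2)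
    (hC : 0 ≤ C) (hred : ∀ t ∈ quarterSector, ‖t‖ ≤ c → ‖reducedAmplitude p ν b t‖ ≤ C)
    (hδ : 0 < δ) :
    ∃ C' : ℝ, 0 ≤ C' ∧ ∀ x : ℂ, |Complex.arg x| ≤ Real.pi / 2 - δ →
      IntegrableOn (fun u : ℝ => logIntegrand p ν a b x
        (u + (-(Complex.arg x) / 2 : ℝ) * Complex.I)) (Set.Iic (Real.log c)) ∧
      ‖I p ν a b (-x) - ∫ u in Set.Iic (Real.log c), logIntegrand p ν a b x
        (u + (-(Complex.arg x) / 2 : ℝ) * Complex.I)‖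
        ≤ C' * Real.exp (-(c * Real.sin δ * ‖x‖)) := by
  obtain ⟨C₁, hC₁, h₁⟩ := norm_logIntegrand_le hp a hc hC hred
  obtain ⟨C₂, hC₂, h₂⟩ := norm_integral_tail_le hp ν a b hc (by linarith)
  refine ⟨C₁ * Real.exp (Real.log c) * Real.pi + C₂, by have := Real.pi_pos; positivity,
    fun x hx => ?_⟩
  set y : ℝ := -(Complex.arg x) / 2 with hy
  have hy4 : |y| ≤ Real.pi / 4 := abs_half_arg_le hδ hx
  have him : ∀ {v : ℝ}, v ∈ Set.uIcc 0 y → |v| ≤ Real.pi / 4 := fun hv =>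
    (abs_le_of_mem_uIcc_zero hv).trans hy4
  have hre : ∀ {u : ℝ}, u ≤ Real.log c → Real.exp u ≤ c := fun hu =>
    (Real.le_log_iff_exp_le hc).1 hu
  have hdiff : ∀ w : ℂ, w.re ≤ Real.log c → w.im ∈ Set.uIcc 0 y →
      DifferentiableAt ℂ (logIntegrand p ν a b x) w := fun w h1 h2 =>
    differentiableAt_logIntegrand hp ν a b x (him h2) ((hre h1).trans hc2)
  have hbound : ∀ w : ℂ, w.re ≤ Real.log c → w.im ∈ Set.uIcc 0 y →
      -- Growth in |x| is harmless here: the bound only justifies Cauchy's theorem and integrability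
      -- for fixed x.
      ‖logIntegrand p ν a b x w‖ ≤ C₁ * Real.exp (‖x‖ * c) * Real.exp w.re := fun w h1 h2 => by
    refine (h₁ x w (him h2) h1).trans ?_
    gcongr
    have h3 := (abs_le.1 (Complex.abs_re_le_norm (x * Complex.exp w))).1
    rw [norm_mul, Complex.norm_exp] at h3
    have : ‖x‖ * Real.exp w.re ≤ ‖x‖ * c := by gcongr; exact hre h1
    linarith
  have hshift := integral_Iic_shift hdiff hbound
  constructor
  · refine integrableOn_line (C := C₁ * Real.exp (‖x‖ * c)) (fun u hu => ?_) fun u hu => ?_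
    · have h1 := (hdiff (u + y * Complex.I) (by simpa using hu) (by simp)).continuousAt
      exact (ContinuousAt.comp (f := fun u : ℝ => (u : ℂ) + y * Complex.I) h1
        (by fun_prop)).continuousWithinAt
    · have := hbound (u + y * Complex.I) (by simpa using hu) (by simp)
      simpa using this
  have hxre : Real.sin δ * ‖x‖ ≤ x.re := by
    rw [← Complex.norm_mul_cos_arg x, mul_comm]
    gcongr
    exact sin_le_cos_of_abs_le hδ hx
  have hsin : 0 ≤ Real.sin δ := Real.sin_nonneg_of_nonneg_of_le_pi hδ.le (by
    have := abs_nonneg (Complex.arg x)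
    have := Real.pi_pos
    linarith)
  have htail := h₂ x (le_trans (by positivity) hxre)
  have harc : ‖∫ v in (0 : ℝ)..y, logIntegrand p ν a b x (Real.log c + v * Complex.I)‖
      ≤ C₁ * Real.exp (-(c * Real.sin δ * ‖x‖)) * Real.exp (Real.log c) * |y - 0| := by
    refine intervalIntegral.norm_integral_le_of_norm_le_const fun v hv => ?_
    have hv' := Set.uIoc_subset_uIcc hv
    have h3 := h₁ x (Real.log c + v * Complex.I) (by simpa using him hv') (by simp)
    refine h3.trans ?_
    have h4 := sin_mul_norm_le_re_mul_exp hδ hx hv' hc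
    have h5 : ((Real.log c : ℂ) + v * Complex.I).re = Real.log c := by simp
    rw [h5]
    gcongr
  have hypi : |y - 0| ≤ Real.pi := by
    rw [sub_zero]
    have := Real.pi_pos
    linarith
  rw [I_neg_eq hp ν a b x hc (by linarith), hshift]
  calc _ = ‖-(Complex.I * ∫ v in (0 : ℝ)..y, logIntegrand p ν a b x
          (Real.log c + v * Complex.I)) +
        (Real.sqrt (2 * p / Real.pi) : ℂ) * ∫ t in c..1, integrand p ν a b (-x) t‖ := by
        congr 1; ring
    _ ≤ C₁ * Real.exp (-(c * Real.sin δ * ‖x‖)) * Real.exp (Real.log c) * |y - 0|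
        + C₂ * Real.exp (-(c * x.re)) := by
        refine (norm_add_le _ _).trans (add_le_add ?_ htail)
        rwa [norm_neg, norm_mul, Complex.norm_I, one_mul]
    _ ≤ C₁ * Real.exp (-(c * Real.sin δ * ‖x‖)) * Real.exp (Real.log c) * Real.pi
        + C₂ * Real.exp (-(c * Real.sin δ * ‖x‖)) := by
        refine add_le_add (mul_le_mul_of_nonneg_left hypi (by positivity))
          (mul_le_mul_of_nonneg_left (Real.exp_le_exp.2 (neg_le_neg ?_)) hC₂)
        rw [mul_assoc]
        exact mul_le_mul_of_nonneg_left hxre hc.le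
    _ = _ := by ring

end contour

/-! ### The ray through the saddle: exact terms and remainder. -/

lemma norm_expansionPoly_le (p ν : ℝ) (b : ℂ) (N : ℕ) {c : ℝ} (hc : 0 < c) :
    ∃ C : ℝ, 0 ≤ C ∧ ∀ t : ℂ, c ≤ ‖t‖ → ‖expansionPoly p ν b N t‖ ≤ C * ‖t‖ ^ N := by
  refine ⟨∑ r ∈ Finset.range N, ‖Complex.exp (-(p : ℂ)) * D p ν b r * (1 / p) ^ r‖ *
    (1 / c) ^ (N - r), by positivity, fun t ht => ?_⟩
  rw [expansionPoly, Finset.sum_mul]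
  refine (norm_sum_le _ _).trans (Finset.sum_le_sum fun r hr => ?_)
  have hr' : r ≤ N := (Finset.mem_range.1 hr).le
  have h1 : 1 ≤ (1 / c) ^ (N - r) * ‖t‖ ^ (N - r) := by
    rw [← mul_pow]
    refine one_le_pow₀ ?_
    rw [one_div_mul_eq_div, le_div_iff₀ hc]
    linarith
  have h2 : ‖t‖ ^ N = ‖t‖ ^ r * ‖t‖ ^ (N - r) := by rw [← pow_add, Nat.add_sub_cancel' hr']
  rw [div_eq_mul_one_div, mul_comm t, mul_pow, ← mul_assoc, norm_mul, norm_pow, h2]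
  have h3 : 0 ≤ ‖Complex.exp (-(p : ℂ)) * D p ν b r * (1 / (p : ℂ)) ^ r‖ * ‖t‖ ^ r := by positivity
  nlinarith

/-- `log √(p/x)`, the logarithm of the saddle point of `e^{-xt-p/t}`. -/
noncomputable def logSaddle (p : ℝ) (x : ℂ) : ℂ := (Real.log p - Complex.log x) / 2

/-- `log √(px)`. -/
noncomputable def logRoot (p : ℝ) (x : ℂ) : ℂ := (Real.log p + Complex.log x) / 2

/-- `2√(px)`, the argument of the Bessel functions in `scale`. -/
noncomputable def besselArg (p : ℝ) (x : ℂ) : ℂ := 2 * Complex.exp (logRoot p x)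

lemma logSaddle_im (p : ℝ) (x : ℂ) : (logSaddle p x).im = -(Complex.arg x) / 2 := by
  rw [logSaddle, show ((Real.log p : ℂ) - Complex.log x) / 2
    = ((1 / 2 : ℝ) : ℂ) * (Real.log p - Complex.log x) by push_cast; ring, Complex.im_ofReal_mul]
  simp [Complex.log_im]
  ring

lemma mul_cpow_eq_exp {p : ℝ} (hp : 0 < p) {x : ℂ} (hx : x ≠ 0) (k : ℂ) :
    ((p : ℂ) * x) ^ k = Complex.exp (2 * k * logRoot p x) := by
  have hp0 : (p : ℂ) ≠ 0 := by exact_mod_cast hp.ne'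
  rw [Complex.cpow_def_of_ne_zero (mul_ne_zero hp0 hx), Complex.log_ofReal_mul hp hx, logRoot]
  congr 1; ring

lemma div_cpow_eq_exp {p : ℝ} (hp : 0 < p) {x : ℂ} (hx : x ≠ 0) (harg : Complex.arg x ≠ Real.pi)
    (k : ℂ) : ((p : ℂ) / x) ^ k = Complex.exp (2 * k * logSaddle p x) := by
  have hp0 : (p : ℂ) ≠ 0 := by exact_mod_cast hp.ne'
  rw [Complex.cpow_def_of_ne_zero (div_ne_zero hp0 hx), div_eq_mul_inv,
    Complex.log_ofReal_mul hp (inv_ne_zero hx), Complex.log_inv _ harg, logSaddle]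
  congr 1; ring

lemma scale_eq {p : ℝ} (hp : 0 < p) (a : ℂ) (r : ℕ) {x : ℂ} (hx : x ≠ 0)
    (harg : Complex.arg x ≠ Real.pi) :
    scale p a r x = 2 * Complex.exp (-(p : ℂ)) * Complex.exp ((a + 1) * logSaddle p x) *
      besselK (a + 1 + r) (besselArg p x) * Complex.exp (-(r * logRoot p x)) := by
  rw [scale, mul_cpow_eq_exp hp hx, mul_cpow_eq_exp hp hx, div_cpow_eq_exp hp hx harg, besselArg]
  congr 3
  · congr 2; ring
  · congr 2
    rw [show (2 : ℂ) * (1 / 2) = 1 by norm_num, one_mul]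
  · ring

/-- At the saddle x t and p/t both equal √(px), so moving by e^s produces a pure cosh. -/
lemma mul_exp_logSaddle_add {p : ℝ} (hp : 0 < p) {x : ℂ} (hx : x ≠ 0) (s : ℝ) :
    x * Complex.exp (logSaddle p x + s) + p * Complex.exp (-(logSaddle p x + s))
      = besselArg p x * Complex.cosh s := by
  have h1 : x * Complex.exp (logSaddle p x + s) = Complex.exp (logRoot p x) * Complex.exp s := by
    nth_rewrite 1 [← Complex.exp_log hx]
    rw [← Complex.exp_add, ← Complex.exp_add, logSaddle, logRoot]
    congr 1; ring
  have h2 : (p : ℂ) * Complex.exp (-(logSaddle p x + s))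
      = Complex.exp (logRoot p x) * Complex.exp (-s) := by
    have : (p : ℂ) = Complex.exp (Real.log p) := by rw [← Complex.ofReal_exp, Real.exp_log hp]
    nth_rewrite 1 [this]
    rw [← Complex.exp_add, ← Complex.exp_add, logSaddle, logRoot]
    congr 1; ring
  rw [h1, h2, besselArg, Complex.cosh]
  ring

/-- The truncated expansion, as an integral along the ray through the saddle point. -/
lemma integral_ray_expansionPoly {p : ℝ} (hp : 0 < p) (ν : ℝ) (a b : ℂ) (N : ℕ) {x : ℂ}
    (hx : x ≠ 0) (harg : Complex.arg x ≠ Real.pi) (hre : 0 < (besselArg p x).re) :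
    Integrable (fun s : ℝ => Complex.exp ((a + 1) * (logSaddle p x + s)) *
      Complex.exp (-besselArg p x * Complex.cosh s) *
      expansionPoly p ν b N (Complex.exp (logSaddle p x + s))) ∧
    ∫ s : ℝ, Complex.exp ((a + 1) * (logSaddle p x + s)) *
      Complex.exp (-besselArg p x * Complex.cosh s) *
      expansionPoly p ν b N (Complex.exp (logSaddle p x + s))
      = ∑ r ∈ Finset.range N, D p ν b r * scale p a r x := by
  set L := logSaddle p x with hL
  set K : ℕ → ℂ := fun r => Complex.exp (-(p : ℂ)) * D p ν b r *
    Complex.exp ((a + 1) * L) * Complex.exp (-(r * logRoot p x)) with hK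
  have hp' : (p : ℂ) = Complex.exp (Real.log p) := by rw [← Complex.ofReal_exp, Real.exp_log hp]
  have hpt : ∀ s : ℝ, Complex.exp ((a + 1) * (L + s)) *
      Complex.exp (-besselArg p x * Complex.cosh s) * expansionPoly p ν b N (Complex.exp (L + s))
      = ∑ r ∈ Finset.range N, K r * (Complex.exp (-besselArg p x * Complex.cosh s) *
        Complex.exp ((a + 1 + r) * s)) := fun s => by
    rw [expansionPoly, Finset.mul_sum]
    refine Finset.sum_congr rfl fun r _ => ?_
    have h1 : (Complex.exp (L + s) / p) ^ r = Complex.exp (-(r * logRoot p x)) *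
        Complex.exp (r * s) := by
      nth_rewrite 1 [hp']
      rw [← Complex.exp_sub, ← Complex.exp_nat_mul, ← Complex.exp_add, hL, logSaddle, logRoot]
      congr 1; ring
    have h2 : Complex.exp ((a + 1) * (L + s)) = Complex.exp ((a + 1) * L) *
        Complex.exp ((a + 1) * s) := by rw [← Complex.exp_add]; congr 1; ring
    have h3 : Complex.exp ((a + 1 + r) * s) = Complex.exp ((a + 1) * s) *
        Complex.exp (r * s) := by rw [← Complex.exp_add]; congr 1; ring
    rw [h1, h2, h3]
    simp only [hK]
    ring
  have hint : ∀ r : ℕ, Integrable (fun s : ℝ => K r *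
      (Complex.exp (-besselArg p x * Complex.cosh s) * Complex.exp ((a + 1 + r) * s))) := fun r =>
    (integrable_cexp_kernel hre (a + 1 + r)).const_mul _
  simp only [hpt]
  refine ⟨integrable_finsetSum _ fun r _ => hint r, ?_⟩
  rw [integral_finsetSum _ fun r _ => hint r]
  refine Finset.sum_congr rfl fun r _ => ?_
  rw [integral_const_mul, integral_cexp_kernel hre, scale_eq hp a r hx harg]
  simp only [hK]
  ring

lemma integral_real_kernel {X : ℝ} (hX : 0 < X) (σ : ℝ) :
    Integrable (fun s : ℝ => Real.exp (-X * Real.cosh s) * Real.exp (σ * s)) ∧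
    ∫ s : ℝ, Real.exp (-X * Real.cosh s) * Real.exp (σ * s) = 2 * ‖besselK σ X‖ := by
  have h := integrable_cexp_kernel (Z := X) (by simpa using hX) σ
  have h2 := integral_cexp_kernel (Z := X) (by simpa using hX) σ
  have e : ∀ s : ℝ, Complex.exp (-(X : ℂ) * Complex.cosh s) * Complex.exp (σ * s)
      = ((Real.exp (-X * Real.cosh s) * Real.exp (σ * s) : ℝ) : ℂ) := fun s => by push_cast; rfl
  simp only [e] at h h2
  have h3 := h.re
  simp only [RCLike.re_to_complex, Complex.ofReal_re] at h3
  refine ⟨h3, ?_⟩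
  rw [integral_complex_ofReal] at h2
  have h4 := congrArg norm h2
  rw [Complex.norm_real, norm_mul, Complex.norm_two, Real.norm_of_nonneg
    (integral_nonneg fun s => by positivity)] at h4
  exact h4

/-- The remainder along the ray through the saddle point. -/
lemma norm_integral_ray_sub_sum_le {p : ℝ} (hp : 0 < p) {ν : ℝ} (a : ℂ) {b : ℂ} (N : ℕ)
    {c C : ℝ} (hc : 0 < c) (hC : 0 ≤ C)
    (hred : ∀ t ∈ quarterSector, ‖t‖ ≤ c →
      ‖reducedAmplitude p ν b t - expansionPoly p ν b N t‖ ≤ C * ‖t‖ ^ N) :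
    ∃ C' : ℝ, 0 ≤ C' ∧ ∀ x : ℂ, x ≠ 0 → |-(Complex.arg x) / 2| ≤ Real.pi / 4 →
      0 < (besselArg p x).re →
      IntegrableOn (fun u : ℝ => logIntegrand p ν a b x
        (u + (-(Complex.arg x) / 2 : ℝ) * Complex.I)) (Set.Iic (Real.log c)) →
      ‖(∫ u in Set.Iic (Real.log c), logIntegrand p ν a b x
        (u + (-(Complex.arg x) / 2 : ℝ) * Complex.I)) -
          ∑ r ∈ Finset.range N, D p ν b r * scale p a r x‖ ≤
      C' * ‖Complex.exp ((a + 1) * logSaddle p x)‖ * ‖Complex.exp (-(N * logRoot p x))‖ *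
        ‖besselK ((a.re + 1 + N : ℝ) : ℂ) ((besselArg p x).re : ℂ)‖ := by
  obtain ⟨C₂, hC₂, h₂⟩ := norm_expansionPoly_le p ν b N hc
  refine ⟨max C C₂ * p ^ N * 2, by positivity, fun x hx hy hre hint => ?_⟩
  have harg : Complex.arg x ≠ Real.pi := fun h => by
    rw [h, abs_div, abs_neg, abs_of_pos Real.pi_pos, abs_of_pos (two_pos (α := ℝ))] at hy
    linarith [Real.pi_pos]
  obtain ⟨hPi, hP⟩ := integral_ray_expansionPoly hp ν a b N hx harg hre
  set L := logSaddle p x with hL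
  have hLim : L.im = -(Complex.arg x) / 2 := logSaddle_im p x
  -- Extension by zero compares both integrals on the whole line: for |t| ≥ c the polynomial alone
  -- is O(|t|^N), so one bound serves everywhere.
  set F : ℝ → ℂ := (Set.Iic (Real.log c)).indicator (fun u : ℝ => logIntegrand p ν a b x
        (u + (-(Complex.arg x) / 2 : ℝ) * Complex.I)) with hF
  have hFi : Integrable F := (integrable_indicator_iff measurableSet_Iic).2 hint
  rw [← integral_indicator measurableSet_Iic, ← hF, ← integral_add_right_eq_self F L.re, ← hP,
    ← integral_sub (hFi.comp_add_right L.re) hPi]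
  obtain ⟨hki, hk⟩ := integral_real_kernel hre (a.re + 1 + N)
  set A := ‖Complex.exp ((a + 1) * L)‖ with hA
  have hroot : p ^ N * ‖Complex.exp (-(N * logRoot p x))‖ = Real.exp (N * L.re) := by
    have hp' : p = ‖Complex.exp (Real.log p)‖ := by
      rw [← Complex.ofReal_exp, Real.exp_log hp, Complex.norm_real, Real.norm_of_nonneg hp.le]
    nth_rewrite 1 [hp']
    rw [← norm_pow, ← norm_mul, ← Complex.exp_nat_mul, ← Complex.exp_add, Complex.norm_exp,
      ← Complex.ofReal_natCast, ← mul_neg, ← mul_add, Complex.re_ofReal_mul, hL, logSaddle,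
      logRoot]
    congr 3
    ring
  have hbound : ∀ s : ℝ, ‖F (s + L.re) - Complex.exp ((a + 1) * (L + s)) *
      Complex.exp (-besselArg p x * Complex.cosh s) * expansionPoly p ν b N (Complex.exp (L + s))‖
      ≤ max C C₂ * A * Real.exp (N * L.re) * (Real.exp (-(besselArg p x).re * Real.cosh s) *
        Real.exp ((a.re + 1 + N) * s)) := fun s => by
    set t := Complex.exp (L + s) with ht
    have hw : |(L + s).im| ≤ Real.pi / 4 := by
      rw [Complex.add_im, Complex.ofReal_im, add_zero, hLim]; exact hy
    have htm : t ∈ quarterSector := exp_mem_quarterSector hw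
    have htn : ‖t‖ = Real.exp (L.re + s) := by rw [ht, Complex.norm_exp]; simp
    have hnorm : ‖Complex.exp ((a + 1) * (L + s)) * Complex.exp (-besselArg p x * Complex.cosh s)‖
        * ‖t‖ ^ N = A * Real.exp (N * L.re) * (Real.exp (-(besselArg p x).re * Real.cosh s) *
          Real.exp ((a.re + 1 + N) * s)) := by
      have h2 : Complex.exp ((a + 1) * (L + s)) = Complex.exp ((a + 1) * L) *
          Complex.exp ((a + 1) * s) := by rw [← Complex.exp_add]; congr 1; ring
      have h3 : ‖Complex.exp ((a + 1) * s)‖ = Real.exp ((a.re + 1) * s) := by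
        rw [Complex.norm_exp, Complex.re_mul_ofReal]; simp
      rw [norm_mul, norm_cexp_neg_mul_cosh, h2, norm_mul, h3, htn, ← Real.exp_nat_mul, mul_add,
        Real.exp_add, add_mul _ (N : ℝ), Real.exp_add]
      ring
    have hkey : ∀ y : ℂ, ‖y‖ ≤ max C C₂ * ‖t‖ ^ N →
        ‖Complex.exp ((a + 1) * (L + s)) * Complex.exp (-besselArg p x * Complex.cosh s) * y‖ ≤
        max C C₂ * A * Real.exp (N * L.re) * (Real.exp (-(besselArg p x).re * Real.cosh s) *
          Real.exp ((a.re + 1 + N) * s)) := fun y hy => by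
      rw [norm_mul]
      calc _ ≤ ‖Complex.exp ((a + 1) * (L + s)) *
            Complex.exp (-besselArg p x * Complex.cosh s)‖ * (max C C₂ * ‖t‖ ^ N) := by gcongr
        _ = max C C₂ * (‖Complex.exp ((a + 1) * (L + s)) *
            Complex.exp (-besselArg p x * Complex.cosh s)‖ * ‖t‖ ^ N) := by ring
        _ = _ := by rw [hnorm]; ring
    by_cases hs : s + L.re ≤ Real.log c
    · have hts : ‖t‖ ≤ c := by
        rw [htn, add_comm]; exact (Real.le_log_iff_exp_le hc).1 hs
      have hLs : ((s + L.re : ℝ) : ℂ) + (-(Complex.arg x) / 2 : ℝ) * Complex.I = L + s := by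
        rw [← hLim]
        apply Complex.ext <;> simp [add_comm]
      have hFs : F (s + L.re) = Complex.exp ((a + 1) * (L + s)) *
          Complex.exp (-besselArg p x * Complex.cosh s) * reducedAmplitude p ν b t := by
        rw [hF, Set.indicator_of_mem (show s + L.re ∈ Set.Iic (Real.log c) from hs), hLs,
          logIntegrand_eq p ν a b x hw, mul_exp_logSaddle_add hp hx, neg_mul]
      rw [hFs, ← mul_sub]
      refine hkey _ ((hred t htm hts).trans ?_)
      gcongr
      exact le_max_left _ _
    · have hts : c ≤ ‖t‖ := by
        rw [htn, add_comm, ← Real.log_le_iff_le_exp hc]; exact (not_le.1 hs).le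
      have hFs : F (s + L.re) = 0 :=
        Set.indicator_of_notMem (show s + L.re ∉ Set.Iic (Real.log c) from hs) _
      rw [hFs, zero_sub, norm_neg]
      refine hkey _ ((h₂ t hts).trans ?_)
      gcongr
      exact le_max_right _ _
  refine (norm_integral_le_of_norm_le (hki.const_mul _) (Eventually.of_forall hbound)).trans
    (le_of_eq ?_)
  rw [integral_const_mul, hk, ← hroot]
  ring

/-! ### The asymptotic scale in the sector. -/

lemma logRoot_im (p : ℝ) (x : ℂ) : (logRoot p x).im = Complex.arg x / 2 := by
  rw [logRoot, show ((Real.log p : ℂ) + Complex.log x) / 2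
    = ((1 / 2 : ℝ) : ℂ) * (Real.log p + Complex.log x) by push_cast; ring, Complex.im_ofReal_mul]
  simp [Complex.log_im]
  ring

lemma norm_exp_logRoot {p : ℝ} (hp : 0 < p) {x : ℂ} (hx : x ≠ 0) :
    ‖Complex.exp (logRoot p x)‖ = √(p * ‖x‖) := by
  have hp0 : (p : ℂ) ≠ 0 := by exact_mod_cast hp.ne'
  have h := mul_cpow_eq_exp hp hx (1 / 2)
  rw [show (2 : ℂ) * (1 / 2) = 1 by norm_num, one_mul] at h
  rw [← h, norm_cpow_half, norm_mul, Complex.norm_real, Real.norm_of_nonneg hp.le]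

lemma besselArg_bounds {p : ℝ} (hp : 0 < p) {x : ℂ} (hx : x ≠ 0)
    (harg : |-(Complex.arg x) / 2| ≤ Real.pi / 4) :
    |(besselArg p x).im| ≤ (besselArg p x).re ∧ √(p * ‖x‖) ≤ (besselArg p x).re ∧
      (besselArg p x).re ≤ 2 * √(p * ‖x‖) := by
  have hm : Complex.exp (logRoot p x) ∈ quarterSector := exp_mem_quarterSector (by
    rw [logRoot_im, ← abs_neg, ← neg_div]; exact harg)
  have h1 : (besselArg p x).re = 2 * (Complex.exp (logRoot p x)).re := by
    rw [besselArg, show (2 : ℂ) = ((2 : ℝ) : ℂ) by push_cast; rfl, Complex.re_ofReal_mul]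
  have h2 : (besselArg p x).im = 2 * (Complex.exp (logRoot p x)).im := by
    rw [besselArg, show (2 : ℂ) = ((2 : ℝ) : ℂ) by push_cast; rfl, Complex.im_ofReal_mul]
  have h3 := norm_le_two_mul_re hm.1
  have h4 := Complex.re_le_norm (Complex.exp (logRoot p x))
  rw [norm_exp_logRoot hp hx] at h3 h4
  rw [h1, h2, abs_mul, abs_two]
  exact ⟨by linarith [hm.1], h3, by linarith⟩

lemma eventually_sectorAtInfinity (δ R : ℝ) :
    ∀ᶠ x in sectorAtInfinity δ, R ≤ ‖x‖ ∧ |Complex.arg x| ≤ Real.pi / 2 - δ := by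
  rw [sectorAtInfinity, eventually_inf_principal]
  filter_upwards [eventually_cobounded_le_norm R] with x hx h using ⟨hx, h⟩

lemma sectorAtInfinity_eq_bot {δ : ℝ} (h : Real.pi / 2 < δ) : sectorAtInfinity δ = ⊥ := by
  refine eq_bot_mono inf_le_right (principal_eq_bot_iff.2 ?_)
  ext x
  simp only [Set.mem_ofPred_eq, Set.mem_empty_iff_false, iff_false, not_le]
  have := abs_nonneg (Complex.arg x)
  linarith

lemma exists_eventually_besselArg {p : ℝ} (hp : 0 < p) {δ : ℝ} (hδ : 0 < δ) (X : ℝ) :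
    ∀ᶠ x in sectorAtInfinity δ, x ≠ 0 ∧ |-(Complex.arg x) / 2| ≤ Real.pi / 4 ∧
      Complex.arg x ≠ Real.pi ∧ |(besselArg p x).im| ≤ (besselArg p x).re ∧
      X ≤ (besselArg p x).re := by
  filter_upwards [eventually_sectorAtInfinity δ (max 1 (X ^ 2 / p))] with x hx
  have hx1 : 1 ≤ ‖x‖ := (le_max_left _ _).trans hx.1
  have hx0 : x ≠ 0 := norm_pos_iff.1 (by linarith)
  have hy := abs_half_arg_le hδ hx.2
  obtain ⟨h1, h2, -⟩ := besselArg_bounds hp hx0 hy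
  refine ⟨hx0, hy, fun h => ?_, h1, le_trans (Real.le_sqrt_of_sq_le ?_) h2⟩
  · have := hx.2
    rw [h, abs_of_pos Real.pi_pos] at this
    linarith [Real.pi_pos]
  · have := (le_max_right _ _).trans hx.1
    rw [div_le_iff₀ hp] at this
    linarith

/-- Macdonald functions of different orders are comparable. -/
lemma norm_besselK_le_mul (μ μ' : ℂ) :
    ∃ C X₀ : ℝ, 0 ≤ C ∧ ∀ Z Z' : ℂ, |Z.im| ≤ Z.re → |Z'.im| ≤ Z'.re → Z.re = Z'.re →
      X₀ ≤ Z.re → ‖besselK μ Z‖ ≤ C * ‖besselK μ' Z'‖ := by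
  obtain ⟨C, X, hC, _, h⟩ := norm_besselK_bounds μ
  obtain ⟨C', X', hC', _, h'⟩ := norm_besselK_bounds μ'
  refine ⟨C * C', max X X', by positivity, fun Z Z' hZ hZ' hre hX => ?_⟩
  have h1 := (h Z hZ ((le_max_left _ _).trans hX)).2
  have h2 := (h' Z' hZ' (((le_max_right _ _).trans hX).trans hre.le)).1
  rw [hre] at h1
  calc _ ≤ C * (Real.exp (-Z'.re) / √Z'.re) := h1
    _ ≤ C * (C' * ‖besselK μ' Z'‖) := by gcongr
    _ = _ := by ring

lemma norm_scale {p : ℝ} (hp : 0 < p) (a : ℂ) (r : ℕ) {x : ℂ} (hx : x ≠ 0)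
    (harg : Complex.arg x ≠ Real.pi) :
    ‖scale p a r x‖ = 2 * Real.exp (-p) * ‖Complex.exp ((a + 1) * logSaddle p x)‖ *
      ‖besselK (a + 1 + r) (besselArg p x)‖ * ‖Complex.exp (-(r * logRoot p x))‖ := by
  rw [scale_eq hp a r hx harg]
  simp only [norm_mul, Complex.norm_two]
  congr 4
  rw [Complex.norm_exp]; simp

/-- The ratio of Macdonald functions stays bounded, so the factor (px)^{-1/2} decides. -/
lemma scale_succ_isLittleO {p : ℝ} (hp : 0 < p) (a : ℂ) {δ : ℝ} (hδ : 0 < δ) (r : ℕ) :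
    scale p a (r + 1) =o[sectorAtInfinity δ] scale p a r := by
  obtain ⟨C, X₀, hC, h⟩ := norm_besselK_le_mul (a + 1 + (r + 1 : ℕ)) (a + 1 + r)
  rw [isLittleO_iff]
  intro ε hε
  filter_upwards [exists_eventually_besselArg hp hδ X₀,
    eventually_sectorAtInfinity δ ((C / ε) ^ 2 / p)] with x ⟨hx, hy, harg, him, hre⟩ hbig
  have hxn : 0 < ‖x‖ := norm_pos_iff.2 hx
  have hs : 0 < √(p * ‖x‖) := Real.sqrt_pos.2 (by positivity)
  have h1 := h _ _ him him rfl hre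
  have h2 : Complex.exp (-((r + 1 : ℕ) * logRoot p x)) =
      Complex.exp (-(r * logRoot p x)) * (Complex.exp (logRoot p x))⁻¹ := by
    rw [← Complex.exp_neg, ← Complex.exp_add]; congr 1; push_cast; ring
  have h3 : C * (√(p * ‖x‖))⁻¹ ≤ ε := by
    rw [← div_eq_mul_inv, div_le_iff₀ hs, ← div_le_iff₀' hε]
    refine Real.le_sqrt_of_sq_le ?_
    have := hbig.1
    rw [div_le_iff₀ hp] at this
    linarith
  rw [norm_scale hp a _ hx harg, norm_scale hp a _ hx harg, h2, norm_mul, norm_inv,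
    norm_exp_logRoot hp hx]
  calc _ ≤ 2 * Real.exp (-p) * ‖Complex.exp ((a + 1) * logSaddle p x)‖ *
      (C * ‖besselK (a + 1 + r) (besselArg p x)‖) *
        (‖Complex.exp (-(r * logRoot p x))‖ * (√(p * ‖x‖))⁻¹) := by gcongr
    _ = (C * (√(p * ‖x‖))⁻¹) * (2 * Real.exp (-p) * ‖Complex.exp ((a + 1) * logSaddle p x)‖ *
      ‖besselK (a + 1 + r) (besselArg p x)‖ * ‖Complex.exp (-(r * logRoot p x))‖) := by ring
    _ ≤ _ := by gcongr

lemma exp_neg_norm_mul_norm_le (k z : ℂ) : Real.exp (-(‖k‖ * ‖z‖)) ≤ ‖Complex.exp (k * z)‖ := by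
  rw [Complex.norm_exp, Real.exp_le_exp]
  have := (abs_le.1 (Complex.abs_re_le_norm (k * z))).1
  rwa [norm_mul] at this

lemma norm_log_pair_le (p : ℝ) {x : ℂ} (hx : 1 ≤ ‖x‖) :
    ‖logSaddle p x‖ ≤ |Real.log p| + Real.pi + 2 * √‖x‖ ∧
      ‖logRoot p x‖ ≤ |Real.log p| + Real.pi + 2 * √‖x‖ := by
  have hl : ‖Complex.log x‖ ≤ 2 * √‖x‖ + Real.pi := by
    refine (Complex.norm_le_abs_re_add_abs_im _).trans (add_le_add ?_ ?_)
    · rw [Complex.log_re, abs_of_nonneg (Real.log_nonneg hx)]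
      have h0 : 0 < √‖x‖ := Real.sqrt_pos.2 (by linarith)
      have h1 := Real.log_le_sub_one_of_pos h0
      rw [Real.log_sqrt (by linarith)] at h1
      linarith
    · rw [Complex.log_im]; exact Complex.abs_arg_le_pi x
  have hp' : ‖(Real.log p : ℂ)‖ = |Real.log p| := by rw [Complex.norm_real, Real.norm_eq_abs]
  have h1 := norm_sub_le (Real.log p : ℂ) (Complex.log x)
  have h2 := norm_add_le (Real.log p : ℂ) (Complex.log x)
  have h3 := norm_nonneg ((Real.log p : ℂ) - Complex.log x)
  have h4 := norm_nonneg ((Real.log p : ℂ) + Complex.log x)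
  rw [logSaddle, logRoot, norm_div, norm_div, Complex.norm_two]
  constructor <;> linarith

/-- Exponentially small terms are negligible against every `scale`. -/
lemma exp_neg_isBigO_scale {p : ℝ} (hp : 0 < p) (a : ℂ) {δ : ℝ} (hδ : 0 < δ) (N : ℕ) {ε : ℝ}
    (hε : 0 < ε) :
    (fun x : ℂ => Real.exp (-(ε * ‖x‖))) =O[sectorAtInfinity δ] scale p a N := by
  obtain ⟨C, X₀, hC, hX₀, h⟩ := norm_besselK_bounds (a + 1 + N)
  set Q := |Real.log p| + Real.pi with hQ
  -- The first part bounds the powers of x through log|x| ≤ 2√|x|; 4√p covers e^{-X} and √X ≤ e^X,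
  -- where X ≤ 2√(p|x|).
  set B := 2 * (‖a + 1‖ + N) + 4 * √p with hB
  refine IsBigO.of_bound (Real.exp (B ^ 2 / (4 * ε) + (‖a + 1‖ + N) * Q + p) * C) ?_
  filter_upwards [exists_eventually_besselArg hp hδ X₀,
    eventually_sectorAtInfinity δ 1] with x ⟨hx, hy, harg, him, hre⟩ hbig
  obtain ⟨-, -, hup⟩ := besselArg_bounds hp hx hy
  obtain ⟨hL, hM⟩ := norm_log_pair_le p hbig.1
  rw [Real.sqrt_mul hp.le] at hup
  set y := √‖x‖ with hyd
  have hy2 : y ^ 2 = ‖x‖ := Real.sq_sqrt (norm_nonneg x)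
  have hX0 : 0 < (besselArg p x).re := hX₀.trans_le hre
  set X := (besselArg p x).re with hX
  have hK := (h _ him hre).1
  have hsq : √X ≤ Real.exp X := by
    refine Real.sqrt_le_iff.2 ⟨(Real.exp_pos _).le, ?_⟩
    have := Real.add_one_le_exp X
    nlinarith
  have hK2 : Real.exp (-(4 * √p * y)) ≤ C * ‖besselK (a + 1 + N) (besselArg p x)‖ := by
    refine le_trans ?_ hK
    rw [le_div_iff₀ (Real.sqrt_pos.2 hX0)]
    calc _ ≤ Real.exp (-(4 * √p * y)) * Real.exp X := by gcongr
      _ = Real.exp (-(4 * √p * y) + X) := by rw [Real.exp_add]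
      _ ≤ _ := Real.exp_le_exp.2 (by linarith)
  have hA : Real.exp (-(‖a + 1‖ * (Q + 2 * y))) ≤ ‖Complex.exp ((a + 1) * logSaddle p x)‖ := by
    refine le_trans (Real.exp_le_exp.2 ?_) (exp_neg_norm_mul_norm_le _ _)
    gcongr
  have hN : Real.exp (-(N * (Q + 2 * y))) ≤ ‖Complex.exp (-(N * logRoot p x))‖ := by
    have h1 := exp_neg_norm_mul_norm_le (-(N : ℂ)) (logRoot p x)
    rw [norm_neg, Complex.norm_natCast, neg_mul] at h1
    refine le_trans (Real.exp_le_exp.2 ?_) h1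
    gcongr
  have hquad : B * y ≤ ε * y ^ 2 + B ^ 2 / (4 * ε) := by
    have : ε * y ^ 2 + B ^ 2 / (4 * ε) - B * y = (2 * ε * y - B) ^ 2 / (4 * ε) := by
      field_simp; ring
    have h2 : 0 ≤ (2 * ε * y - B) ^ 2 / (4 * ε) := by positivity
    linarith
  rw [norm_scale hp a _ hx harg, Real.norm_of_nonneg (Real.exp_pos _).le]
  set E := Real.exp (B ^ 2 / (4 * ε) + (‖a + 1‖ + N) * Q + p) with hE
  calc Real.exp (-(ε * ‖x‖)) ≤ Real.exp ((B ^ 2 / (4 * ε) + (‖a + 1‖ + N) * Q + p) + (-p +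
        (-(‖a + 1‖ * (Q + 2 * y)) + (-(4 * √p * y) + -(N * (Q + 2 * y)))))) := by
        refine Real.exp_le_exp.2 ?_
        rw [← hy2]
        have : B * y = (2 * (‖a + 1‖ + N) + 4 * √p) * y := by rw [hB]
        linarith
    _ = E * (Real.exp (-p) * (Real.exp (-(‖a + 1‖ * (Q + 2 * y))) *
        (Real.exp (-(4 * √p * y)) * Real.exp (-(N * (Q + 2 * y)))))) := by
        rw [Real.exp_add, Real.exp_add (-p), Real.exp_add (-(‖a + 1‖ * (Q + 2 * y))),
          Real.exp_add (-(4 * √p * y))]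
    _ ≤ E * (2 * Real.exp (-p) * (‖Complex.exp ((a + 1) * logSaddle p x)‖ *
        (C * ‖besselK (a + 1 + N) (besselArg p x)‖ * ‖Complex.exp (-(N * logRoot p x))‖))) := by
        gcongr
        have := Real.exp_pos (-p)
        linarith
    _ = _ := by ring

/-! ### Assembly of the expansions. -/

lemma expansion_neg {p : ℝ} (hp : 0 < p) (ν : ℝ) (a b : ℂ) {δ : ℝ} (hδ : 0 < δ) :
    HasAsymptoticExpansion (sectorAtInfinity δ) (fun x => I p ν a b (-x)) (D p ν b)
      (scale p a) := by
  refine ⟨fun r => scale_succ_isLittleO hp a hδ r, fun N => ?_⟩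
  -- For δ > π/2 the sector is empty; otherwise sin δ > 0, as the exponential error needs.
  rcases lt_or_ge (Real.pi / 2) δ with hbig | hδ2
  · rw [sectorAtInfinity_eq_bot hbig]; exact IsBigO.of_bound 1 (by simp)
  obtain ⟨c, C, hc, hc2, hC, hred⟩ := exists_radius hp ν b N
  obtain ⟨C₁, hC₁, h₁⟩ := norm_I_sub_integral_ray_le hp ν a b hc hc2 hC
    (fun t ht hn => (hred t ht hn).2) hδ
  obtain ⟨C₂, hC₂, h₂⟩ := norm_integral_ray_sub_sum_le hp a N hc hC
    (fun t ht hn => (hred t ht hn).1)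
  -- Trades the real order and argument from the absolute-value estimate for the complex ones in
  -- φ_N.
  obtain ⟨C₃, X₀, hC₃, h₃⟩ := norm_besselK_le_mul ((a.re + 1 + N : ℝ) : ℂ) (a + 1 + N)
  have hsin : 0 < Real.sin δ := Real.sin_pos_of_pos_of_lt_pi hδ (by linarith [Real.pi_pos])
  set J : ℂ → ℂ := fun x => ∫ u in Set.Iic (Real.log c), logIntegrand p ν a b x
        (u + (-(Complex.arg x) / 2 : ℝ) * Complex.I) with hJ
  have hfirst : (fun x => I p ν a b (-x) - J x) =O[sectorAtInfinity δ] scale p a N := by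
    have hexp := exp_neg_isBigO_scale hp a hδ N (mul_pos hc hsin)
    refine IsBigO.trans (IsBigO.of_bound C₁ ?_) hexp
    filter_upwards [eventually_sectorAtInfinity δ 0] with x hx
    rw [Real.norm_of_nonneg (Real.exp_pos _).le]
    exact (h₁ x hx.2).2
  have hsecond : (fun x => J x - ∑ r ∈ Finset.range N, D p ν b r * scale p a r x)
      =O[sectorAtInfinity δ] scale p a N := by
    refine IsBigO.of_bound (C₂ * C₃ * Real.exp p) ?_
    filter_upwards [exists_eventually_besselArg hp hδ (max 1 X₀),
      eventually_sectorAtInfinity δ 0] with x ⟨hx, hy, harg, him, hre⟩ hs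
    have hre0 : 0 < (besselArg p x).re := by linarith [(le_max_left _ _).trans hre]
    refine (h₂ x hx hy hre0 (h₁ x hs.2).1).trans ?_
    have hK := h₃ ((besselArg p x).re : ℂ) (besselArg p x) (by simpa using hre0.le) him
      (by simp) (by simpa using (le_max_right _ _).trans hre)
    rw [norm_scale hp a _ hx harg]
    have he : Real.exp p * Real.exp (-p) = 1 := by rw [← Real.exp_add]; simp
    calc _ ≤ C₂ * ‖Complex.exp ((a + 1) * logSaddle p x)‖ * ‖Complex.exp (-(N * logRoot p x))‖ *
          (C₃ * ‖besselK (a + 1 + N) (besselArg p x)‖) := by gcongr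
      _ ≤ 2 * (C₂ * ‖Complex.exp ((a + 1) * logSaddle p x)‖ *
          ‖Complex.exp (-(N * logRoot p x))‖ *
          (C₃ * ‖besselK (a + 1 + N) (besselArg p x)‖)) :=
          le_mul_of_one_le_left (by positivity) one_le_two
      _ = (Real.exp p * Real.exp (-p)) * (2 * (C₂ * ‖Complex.exp ((a + 1) * logSaddle p x)‖ *
          ‖Complex.exp (-(N * logRoot p x))‖ *
          (C₃ * ‖besselK (a + 1 + N) (besselArg p x)‖))) := by rw [he, one_mul]
      _ = _ := by ring
  refine (hfirst.add hsecond).congr_left fun x => ?_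
  ring

lemma HasAsymptoticExpansion.mul_left {l : Filter ℂ} {f : ℂ → ℂ} {c : ℕ → ℂ} {φ : ℕ → ℂ → ℂ}
    (h : HasAsymptoticExpansion l f c φ) (g : ℂ → ℂ) :
    HasAsymptoticExpansion l (fun x => g x * f x) c (fun r x => g x * φ r x) := by
  refine ⟨fun r => (isBigO_refl g l).mul_isLittleO (h.1 r), fun N => ?_⟩
  refine ((isBigO_refl g l).mul (h.2 N)).congr_left fun x => ?_
  rw [mul_sub, Finset.mul_sum]
  congr 1
  exact Finset.sum_congr rfl fun r _ => by ring

end BesselLaplace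

theorem mainTheorem3 (p ν : ℝ) (hp : 0 < p) (hν : -(1 / 2) ≤ ν) (a b : ℂ) :
    (∀ z : ℂ, IntervalIntegrable (BesselLaplace.integrand p ν a b z) volume 0 1) ∧
    BesselLaplace.D p ν b 0 = 1 ∧
    (∀ δ : ℝ, 0 < δ →
      BesselLaplace.HasAsymptoticExpansion (BesselLaplace.sectorAtInfinity δ)
        (fun x => BesselLaplace.I p ν a b (-x))
        (BesselLaplace.D p ν b) (BesselLaplace.scale p a)) ∧
    (∀ z : ℂ, BesselLaplace.I p ν a b z = Complex.exp z * BesselLaplace.I p ν b a (-z)) ∧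
    (∀ δ : ℝ, 0 < δ →
      BesselLaplace.HasAsymptoticExpansion (BesselLaplace.sectorAtInfinity δ)
        (fun z => BesselLaplace.I p ν a b z)
        (BesselLaplace.D p ν a) (fun r z => Complex.exp z * BesselLaplace.scale p b r z)) := by
  refine ⟨BesselLaplace.intervalIntegrable_integrand hp ν a b, BesselLaplace.D_zero p ν b,
    fun δ hδ => BesselLaplace.expansion_neg hp ν a b hδ, BesselLaplace.I_symm p ν a b,
    fun δ hδ => ?_⟩
  -- Part (iii) is part (i) with a and b exchanged, multiplied by e^z and read through the
  -- reflection.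
  have h := (BesselLaplace.expansion_neg hp ν b a hδ).mul_left Complex.exp
  simp only [← BesselLaplace.I_symm p ν a b] at h
  exact h
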